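/- Let $\mathbb C$ be a pretopos, i.e. a Barr-exact category with finite coproducts which is extensive. Let $\mathsf{PreOrd}(\mathbb C)$ be the category of internal preorders $(A,\rho)$ in $\mathbb C$ (reflexive and transitive relations $\rho\rightarrowtail A\times A$) and let $\mathsf{Eq}(\mathbb C)$ and $\mathsf{ParOrd}(\mathbb C)$ be its full subcategories of internal equivalence relations and internal partial orders. Put $\mathcal Z=\mathsf{Eq}(\mathbb C)\cap\mathsf{ParOrd}(\mathbb C)$ (the discrete preorders); a morphism is *trivial* if it factors through an object of $\mathcal Z$, and $\mathcal Z$-kernels, $\mathcal Z$-cokernels and short $\mathcal Z$-exact sequences are defined like kernels, cokernels and short exact sequences, with trivial morphisms in place of zero morphisms. A subobject of $X$ in $\mathsf{PreOrd}(\mathbb C)$ is *complemented* if there is another subobject of $X$ whose intersection with it is $0$ and whose union with it is $X$. Let $\mathsf{PaPreOrd}(\mathbb C)$ be the category with the same objects as $\mathsf{PreOrd}(\mathbb C)$ whose morphisms $A\to B$ are the spans $(\alpha,f)$, up to isomorphism, with $\alpha\colon A'\rightarrowtail A$ a complemented subobject and $f\colon A'\to B$ a morphism in $\mathsf{PreOrd}(\mathbb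 C)$, composed by pullback. Two parallel morphisms $(\alpha_1,f_1)$, $(\alpha_2,f_2)\colon A\to B$, with domains $A_1,A_2$, are *equivalent* if there are a complemented subobject $\alpha_0\colon A_0\rightarrowtail A$ and complemented subobjects $\alpha_0^i\colon A_0\rightarrowtail A_i$ with $\alpha_i\alpha_0^i=\alpha_0$ $(i=1,2)$, such that $f_1\alpha_0^1=f_2\alpha_0^2$ and each $f_i$ is trivial on the complement of $A_0$ in $A_i$. Let the stable category $\mathsf{Stab}(\mathbb C)$ be the quotient of $\mathsf{PaPreOrd}(\mathbb C)$ by this congruence; it is pointed, with zero object $0$. Let $\Sigma\colon\mathsf{PreOrd}(\mathbb C)\to\mathsf{Stab}(\mathbb C)$ be the functor that is the identity on objects and sends $f$ to the class of $(1,f)$. Then: 1. $(\mathsf{Eq}(\mathbb C),\mathsf{ParOrd}(\mathbb C))$ is a pretorsion theory in $\mathsf{PreOrd}(\mathbb C)$: both subcategories are replete, every morphism from an equivalence relation to a partial order is trivial, and for every $A$ there is a short $\mathcal Z$-exact sequence $T(A)\to A\to F(A)$ with $T(A)\in\mathsf{Eq}(\mathbb C)$ and $F(A)\in\mathsf{ParOrd}(\mathbb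 C)$. 2. $(\mathsf{Eq}(\mathbb C),\mathsf{ParOrd}(\mathbb C))$ is a torsion theory in the pointed category $\mathsf{Stab}(\mathbb C)$: both classes of objects are closed under isomorphism in $\mathsf{Stab}(\mathbb C)$, every morphism of $\mathsf{Stab}(\mathbb C)$ from an equivalence relation to a partial order is zero, and for every $A$ there is a short exact sequence $0\to T\to A\to F\to 0$ in $\mathsf{Stab}(\mathbb C)$ with $T$ an equivalence relation and $F$ a partial order (the first map a kernel of the second, the second a cokernel of the first). 3. $\Sigma$ is a torsion theory functor: it sends equivalence relations to equivalence relations and partial orders to partial orders, and it sends every short $\mathcal Z$-exact sequence $T(A)\to A\to F(A)$ with $T(A)\in\mathsf{Eq}(\mathbb C)$ and $F(A)\in\mathsf{ParOrd}(\mathbb C)$ to a short exact sequence in $\mathsf{Stab}(\mathbb C)$. 4. $\Sigma$ preserves finite coproducts. 5. $\Sigma$ preserves monomorphisms. -/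

import Mathlib

open CategoryTheory CategoryTheory.Limits

universe v u v₁ u₁ v₂ u₂

/-! ## Pretorsion theories, torsion theories and torsion theory functors -/

section TorsionTheories

variable {A : Type u₁} [Category.{v₁} A] {B : Type u₂} [Category.{v₂} B]

/-- A morphism is `Z`-trivial if it factors through an object of `Z`. -/
def IsTrivialHom (Z : ObjectProperty A) {X Y : A} (f : X ⟶ Y) : Prop :=
  ∃ (W : A) (_ : Z W) (a : X ⟶ W) (b : W ⟶ Y), a ≫ b = f

/-- `k` is a `Z`-kernel of `f`. -/
def IsZKernel (Z : ObjectProperty A) {K X Y : A} (k : K ⟶ X) (f : X ⟶ Y) : Prop :=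
  IsTrivialHom Z (k ≫ f) ∧
    ∀ ⦃W : A⦄ (l : W ⟶ X), IsTrivialHom Z (l ≫ f) → ∃! l' : W ⟶ K, l' ≫ k = l

/-- `c` is a `Z`-cokernel of `f`. -/
def IsZCokernel (Z : ObjectProperty A) {X Y Q : A} (f : X ⟶ Y) (c : Y ⟶ Q) : Prop :=
  IsTrivialHom Z (f ≫ c) ∧
    ∀ ⦃W : A⦄ (l : Y ⟶ W), IsTrivialHom Z (f ≫ l) → ∃! l' : Q ⟶ W, c ≫ l' = l

/-- `X ⟶ Y ⟶ W` is a short `Z`-exact sequence. -/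
def IsShortZExact (Z : ObjectProperty A) {X Y W : A} (f : X ⟶ Y) (g : Y ⟶ W) : Prop :=
  IsZKernel Z f g ∧ IsZCokernel Z f g

/-- `(T, F)` is a pretorsion theory in `A`; the class of trivial objects is `T ⊓ F`. -/
structure IsPretorsionTheory (T F : ObjectProperty A) : Prop where
  replete_torsion : T.IsClosedUnderIsomorphisms
  replete_torsionFree : F.IsClosedUnderIsomorphisms
  trivial_hom : ∀ ⦃X Y : A⦄ (f : X ⟶ Y), T X → F Y → IsTrivialHom (T ⊓ F) f
  exists_exact : ∀ X : A, ∃ (TX FX : A) (_ : T TX) (_ : F FX) (f : TX ⟶ X) (g : X ⟶ FX),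
    IsShortZExact (T ⊓ F) f g

/-- In a category with zero morphisms, `0 ⟶ X ⟶ Y ⟶ W ⟶ 0` is a short exact sequence:
`f` is a kernel of `g` and `g` is a cokernel of `f`. -/
def IsShortExactSeq [HasZeroMorphisms B] {X Y W : B} (f : X ⟶ Y) (g : Y ⟶ W) : Prop :=
  ∃ w : f ≫ g = 0,
    Nonempty (IsLimit (KernelFork.ofι f w)) ∧ Nonempty (IsColimit (CokernelCofork.ofπ g w))

/-- `(T, F)` is a torsion theory in the pointed category `B`. -/
structure IsTorsionTheory [HasZeroObject B] [HasZeroMorphisms B]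
    (T F : ObjectProperty B) : Prop where
  replete_torsion : T.IsClosedUnderIsomorphisms
  replete_torsionFree : F.IsClosedUnderIsomorphisms
  zero_hom : ∀ ⦃X Y : B⦄ (f : X ⟶ Y), T X → F Y → f = 0
  exists_exact : ∀ X : B, ∃ (TX FX : B) (_ : T TX) (_ : F FX) (f : TX ⟶ X) (g : X ⟶ FX),
    IsShortExactSeq f g

/-- `G` is a torsion theory functor from `A`, with its pretorsion theory `(T, F)`, to the pointed
category `B`, with its torsion theory `(T', F')`. The canonical sequence of an object `X` is the
short `Z`-exact sequence `TX ⟶ X ⟶ FX` with `TX` in `T` and `FX` in `F`, which is unique up to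
isomorphism. -/
structure IsTorsionTheoryFunctor [HasZeroObject B] [HasZeroMorphisms B]
    (T F : ObjectProperty A) (T' F' : ObjectProperty B) (G : A ⥤ B) : Prop where
  pretorsionTheory : IsPretorsionTheory T F
  torsionTheory : IsTorsionTheory T' F'
  map_torsion : ∀ X : A, T X → T' (G.obj X)
  map_torsionFree : ∀ X : A, F X → F' (G.obj X)
  map_exact : ∀ ⦃TX X FX : A⦄ (f : TX ⟶ X) (g : X ⟶ FX), T TX → F FX →
    IsShortZExact (T ⊓ F) f g → IsShortExactSeq (G.map f) (G.map g)

end TorsionTheories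

/-! ## Pretoposes -/

/-- A pretopos: a Barr-exact category (regular, and every equivalence relation is effective) with
finite coproducts that is extensive. -/
class IsPretopos (C : Type u) [Category.{v} C] : Prop extends Regular C, FinitaryExtensive C where
  effective : ∀ {R X : C} (p₁ p₂ : R ⟶ X),
    IsEquivalenceRelation p₁ p₂ → IsEffectiveEquivalenceRelation p₁ p₂

/-! ## Binary coproduct diagrams in a pretopos -/

/-- `A₁ ⟶ A ⟵ A₂` is a coproduct diagram. -/
def IsSum {C : Type u} [Category.{v} C] {A₁ A₂ A : C} (i₁ : A₁ ⟶ A) (i₂ : A₂ ⟶ A) : Prop :=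
  Nonempty (IsColimit (BinaryCofan.mk i₁ i₂))

namespace IsSum

variable {C : Type u} [Category.{v} C] {A₁ A₂ A : C} {i₁ : A₁ ⟶ A} {i₂ : A₂ ⟶ A}

theorem hom_ext (h : IsSum i₁ i₂) {T : C} {f g : A ⟶ T} (h₁ : i₁ ≫ f = i₁ ≫ g)
    (h₂ : i₂ ≫ f = i₂ ≫ g) : f = g := by
  obtain ⟨h⟩ := h
  exact BinaryCofan.IsColimit.hom_ext h h₁ h₂

theorem exists_desc (h : IsSum i₁ i₂) {T : C} (f : A₁ ⟶ T) (g : A₂ ⟶ T) :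
    ∃ d : A ⟶ T, i₁ ≫ d = f ∧ i₂ ≫ d = g := by
  obtain ⟨h⟩ := h
  obtain ⟨d, h₁, h₂⟩ := BinaryCofan.IsColimit.desc' h f g
  exact ⟨d, h₁, h₂⟩

theorem of_desc (hd : ∀ {T : C} (f : A₁ ⟶ T) (g : A₂ ⟶ T), ∃ d : A ⟶ T, i₁ ≫ d = f ∧ i₂ ≫ d = g)
    (hu : ∀ {T : C} (f g : A ⟶ T), i₁ ≫ f = i₁ ≫ g → i₂ ≫ f = i₂ ≫ g → f = g) :
    IsSum i₁ i₂ :=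
  ⟨BinaryCofan.isColimitMk (fun s => (hd s.inl s.inr).choose)
    (fun s => (hd s.inl s.inr).choose_spec.1) (fun s => (hd s.inl s.inr).choose_spec.2)
    (fun s _ h₁ h₂ => hu _ _ (h₁.trans (hd s.inl s.inr).choose_spec.1.symm)
      (h₂.trans (hd s.inl s.inr).choose_spec.2.symm))⟩

theorem coprod [HasBinaryCoproducts C] (X Y : C) :
    IsSum (coprod.inl : X ⟶ X ⨿ Y) (coprod.inr : Y ⟶ X ⨿ Y) :=
  ⟨coprodIsCoprod X Y⟩

theorem of_isIso {i₁ : A₁ ⟶ A} [IsIso i₁] (hA : IsInitial A₂) (i₂ : A₂ ⟶ A) : IsSum i₁ i₂ :=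
  (BinaryCofan.isColimit_iff_isIso_inl hA (BinaryCofan.mk i₁ i₂)).2 (by assumption)

/-- A monomorphism through which both legs of a coproduct diagram factor is invertible. -/
theorem isIso_of_mono (h : IsSum i₁ i₂) {E : C} (m : E ⟶ A) [Mono m] (e₁ : A₁ ⟶ E) (e₂ : A₂ ⟶ E)
    (h₁ : e₁ ≫ m = i₁) (h₂ : e₂ ≫ m = i₂) : IsIso m := by
  obtain ⟨d, hd₁, hd₂⟩ := h.exists_desc e₁ e₂
  have hdm : d ≫ m = 𝟙 A := h.hom_ext (by rw [← Category.assoc, hd₁, h₁, Category.comp_id])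
    (by rw [← Category.assoc, hd₂, h₂, Category.comp_id])
  exact ⟨d, by rw [← cancel_mono m, Category.assoc, hdm]; simp, hdm⟩

theorem comp_iso (h : IsSum i₁ i₂) {A' : C} (e : A ⟶ A') (_ : IsIso e) :
    IsSum (i₁ ≫ e) (i₂ ≫ e) := by
  refine of_desc (fun f g => ?_) (fun f g h₁ h₂ => ?_)
  · obtain ⟨d, hd₁, hd₂⟩ := h.exists_desc f g
    exact ⟨inv e ≫ d, by simp [hd₁], by simp [hd₂]⟩
  · rw [← cancel_epi e]
    exact h.hom_ext (by simpa using h₁) (by simpa using h₂)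

/-- Associativity of coproduct diagrams. -/
theorem assoc (h : IsSum i₁ i₂) {B₁ B₂ S : C} {j₁ : B₁ ⟶ A₁} {j₂ : B₂ ⟶ A₁} (hj : IsSum j₁ j₂)
    {s₁ : B₂ ⟶ S} {s₂ : A₂ ⟶ S} (hs : IsSum s₁ s₂) (t : S ⟶ A) (ht₁ : s₁ ≫ t = j₂ ≫ i₁)
    (ht₂ : s₂ ≫ t = i₂) : IsSum (j₁ ≫ i₁) t := by
  refine of_desc (fun f g => ?_) (fun f g h₁ h₂ => ?_)
  · obtain ⟨d, hd₁, hd₂⟩ := hj.exists_desc f (s₁ ≫ g)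
    obtain ⟨e, he₁, he₂⟩ := h.exists_desc d (s₂ ≫ g)
    refine ⟨e, by rw [Category.assoc, he₁, hd₁], hs.hom_ext ?_ ?_⟩
    · rw [← Category.assoc, ht₁, Category.assoc, he₁, hd₂]
    · rw [← Category.assoc, ht₂, he₂]
  · refine h.hom_ext (hj.hom_ext (by simpa using h₁) ?_) ?_
    · rw [← Category.assoc, ← Category.assoc, ← ht₁, Category.assoc, Category.assoc, h₂]
    · rw [← ht₂, Category.assoc, Category.assoc, h₂]

variable [IsPretopos C]

theorem pullback (h : IsSum i₁ i₂) {T : C} (f : T ⟶ A) :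
    IsSum (pullback.fst f i₁) (pullback.fst f i₂) := by
  obtain ⟨h⟩ := h
  exact ((BinaryCofan.isVanKampen_iff _).1 (FinitaryExtensive.vanKampen _ h)
    (BinaryCofan.mk (pullback.fst f i₁) (pullback.fst f i₂)) (pullback.snd f i₁)
    (pullback.snd f i₂) f pullback.condition.symm pullback.condition.symm).2
    ⟨IsPullback.of_hasPullback f i₁, IsPullback.of_hasPullback f i₂⟩

theorem mono_inl (h : IsSum i₁ i₂) : Mono i₁ := by
  obtain ⟨h⟩ := h
  exact FinitaryExtensive.mono_inl_of_isColimit h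

theorem mono_inr (h : IsSum i₁ i₂) : Mono i₂ := by
  obtain ⟨h⟩ := h
  exact FinitaryExtensive.mono_inr_of_isColimit h

theorem disjoint (h : IsSum i₁ i₂) {T : C} (x : T ⟶ A₁) (y : T ⟶ A₂) (hxy : x ≫ i₁ = y ≫ i₂) :
    Nonempty (IsInitial T) := by
  obtain ⟨h⟩ := h
  exact ⟨IsInitial.ofStrict ((FinitaryExtensive.isPullback_initial_to_binaryCofan h).lift x y hxy)
    initialIsInitial⟩

theorem isInitial (h : IsSum i₁ i₂) (h₁ : Nonempty (IsInitial A₁)) (h₂ : Nonempty (IsInitial A₂)) :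
    Nonempty (IsInitial A) := by
  obtain ⟨h₁⟩ := h₁
  obtain ⟨h₂⟩ := h₂
  obtain ⟨d, -, -⟩ := h.exists_desc (h₁.to (⊥_ C)) (h₂.to (⊥_ C))
  exact ⟨IsInitial.ofStrict d initialIsInitial⟩

/-- The morphism from a coproduct induced by two disjoint monomorphisms is a monomorphism. -/
theorem mono_of_disjoint (h : IsSum i₁ i₂) {X : C} (m : A ⟶ X) (m₁ : Mono (i₁ ≫ m))
    (m₂ : Mono (i₂ ≫ m))
    (hd : ∀ {T : C} (x : T ⟶ A₁) (y : T ⟶ A₂), x ≫ i₁ ≫ m = y ≫ i₂ ≫ m → Nonempty (IsInitial T)) :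
    Mono m := by
  refine ⟨fun {T} f g hfg => (h.pullback f).hom_ext ?_ ?_⟩
  · refine (h.pullback (pullback.fst f i₁ ≫ g)).hom_ext ?_ ?_
    · have e₁ := pullback.condition (f := f) (g := i₁)
      have e₂ := pullback.condition (f := pullback.fst f i₁ ≫ g) (g := i₁)
      have : pullback.fst (pullback.fst f i₁ ≫ g) i₁ ≫ pullback.snd f i₁ =
          pullback.snd (pullback.fst f i₁ ≫ g) i₁ := by
        rw [← cancel_mono (i₁ ≫ m)]
        rw [Category.assoc, ← Category.assoc _ i₁ m, ← e₁, ← Category.assoc _ i₁ m, ← e₂]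
        simp [hfg]
      rw [e₁, ← Category.assoc, this, e₂]
    · have e₁ := pullback.condition (f := f) (g := i₁)
      have e₂ := pullback.condition (f := pullback.fst f i₁ ≫ g) (g := i₂)
      obtain ⟨hI⟩ := hd (pullback.fst (pullback.fst f i₁ ≫ g) i₂ ≫ pullback.snd f i₁)
        (pullback.snd (pullback.fst f i₁ ≫ g) i₂) (by
          rw [Category.assoc, ← Category.assoc _ i₁ m, ← e₁, ← Category.assoc _ i₂ m, ← e₂]
          simp [hfg])
      exact hI.hom_ext _ _
  · refine (h.pullback (pullback.fst f i₂ ≫ g)).hom_ext ?_ ?_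
    · have e₁ := pullback.condition (f := f) (g := i₂)
      have e₂ := pullback.condition (f := pullback.fst f i₂ ≫ g) (g := i₁)
      obtain ⟨hI⟩ := hd (pullback.snd (pullback.fst f i₂ ≫ g) i₁)
        (pullback.fst (pullback.fst f i₂ ≫ g) i₁ ≫ pullback.snd f i₂) (by
          rw [Category.assoc, ← Category.assoc _ i₂ m, ← e₁, ← Category.assoc _ i₁ m, ← e₂]
          simp [hfg])
      exact hI.hom_ext _ _
    · have e₁ := pullback.condition (f := f) (g := i₂)
      have e₂ := pullback.condition (f := pullback.fst f i₂ ≫ g) (g := i₂)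
      have : pullback.fst (pullback.fst f i₂ ≫ g) i₂ ≫ pullback.snd f i₂ =
          pullback.snd (pullback.fst f i₂ ≫ g) i₂ := by
        rw [← cancel_mono (i₂ ≫ m)]
        rw [Category.assoc, ← Category.assoc _ i₂ m, ← e₁, ← Category.assoc _ i₂ m, ← e₂]
        simp [hfg]
      rw [e₁, ← Category.assoc, this, e₂]

end IsSum

/-! ## Internal preorders -/

/-- An internal preorder in `C`: a relation `r₁, r₂ : rel ⟶ carrier` (a jointly monic pair, i.e. a
subobject of `carrier × carrier`) that is reflexive and transitive. -/
structure InternalPreorder (C : Type u) [Category.{v} C] [IsPretopos C] where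
  carrier : C
  rel : C
  r₁ : rel ⟶ carrier
  r₂ : rel ⟶ carrier
  jointlyMono : JointlyMono₂ r₁ r₂
  reflexive : ∃ e : carrier ⟶ rel, e ≫ r₁ = 𝟙 carrier ∧ e ≫ r₂ = 𝟙 carrier
  transitive : ∃ t : pullback r₂ r₁ ⟶ rel,
    t ≫ r₁ = pullback.fst r₂ r₁ ≫ r₁ ∧ t ≫ r₂ = pullback.snd r₂ r₁ ≫ r₂

namespace InternalPreorder

variable {C : Type u} [Category.{v} C] [IsPretopos C]

/-- The relation on generalized elements. -/
def le (X : InternalPreorder C) {T : C} (x y : T ⟶ X.carrier) : Prop :=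
  ∃ h : T ⟶ X.rel, h ≫ X.r₁ = x ∧ h ≫ X.r₂ = y

theorem rel_hom_ext (X : InternalPreorder C) {T : C} {f g : T ⟶ X.rel}
    (h₁ : f ≫ X.r₁ = g ≫ X.r₁) (h₂ : f ≫ X.r₂ = g ≫ X.r₂) : f = g :=
  X.jointlyMono.right_cancellation f g h₁ h₂

theorem le_refl (X : InternalPreorder C) {T : C} (x : T ⟶ X.carrier) : X.le x x := by
  obtain ⟨e, h₁, h₂⟩ := X.reflexive
  exact ⟨x ≫ e, by simp [h₁], by simp [h₂]⟩

theorem le_trans (X : InternalPreorder C) {T : C} {x y z : T ⟶ X.carrier} (hxy : X.le x y)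
    (hyz : X.le y z) : X.le x z := by
  obtain ⟨t, h₁, h₂⟩ := X.transitive
  obtain ⟨h, rfl, hy⟩ := hxy
  obtain ⟨k, hy', rfl⟩ := hyz
  exact ⟨pullback.lift h k (hy.trans hy'.symm) ≫ t,
    by rw [Category.assoc, h₁, pullback.lift_fst_assoc],
    by rw [Category.assoc, h₂, pullback.lift_snd_assoc]⟩

theorem comp_le (X : InternalPreorder C) {S T : C} (f : S ⟶ T) {x y : T ⟶ X.carrier}
    (h : X.le x y) : X.le (f ≫ x) (f ≫ y) := by
  obtain ⟨k, rfl, rfl⟩ := h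
  exact ⟨f ≫ k, by simp, by simp⟩

/-- A morphism of internal preorders. -/
@[ext]
structure Hom (X Y : InternalPreorder C) where
  base : X.carrier ⟶ Y.carrier
  rel : X.rel ⟶ Y.rel
  w₁ : X.r₁ ≫ base = rel ≫ Y.r₁
  w₂ : X.r₂ ≫ base = rel ≫ Y.r₂

instance : Category (InternalPreorder C) where
  Hom := Hom
  id X := ⟨𝟙 _, 𝟙 _, by simp, by simp⟩
  comp f g := ⟨f.base ≫ g.base, f.rel ≫ g.rel,
    by rw [← Category.assoc, f.w₁, Category.assoc, g.w₁, Category.assoc],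
    by rw [← Category.assoc, f.w₂, Category.assoc, g.w₂, Category.assoc]⟩
  id_comp f := by apply Hom.ext <;> simp
  comp_id f := by apply Hom.ext <;> simp
  assoc f g h := by apply Hom.ext <;> simp

@[simp] theorem id_base (X : InternalPreorder C) : (𝟙 X : X ⟶ X).base = 𝟙 X.carrier := rfl

@[simp] theorem id_rel (X : InternalPreorder C) : (𝟙 X : X ⟶ X).rel = 𝟙 X.rel := rfl

@[simp] theorem comp_base {X Y Z : InternalPreorder C} (f : X ⟶ Y) (g : Y ⟶ Z) :
    (f ≫ g).base = f.base ≫ g.base := rfl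

@[simp] theorem comp_rel {X Y Z : InternalPreorder C} (f : X ⟶ Y) (g : Y ⟶ Z) :
    (f ≫ g).rel = f.rel ≫ g.rel := rfl

theorem hom_ext {X Y : InternalPreorder C} {f g : X ⟶ Y} (h : f.base = g.base) : f = g :=
  Hom.ext h (Y.rel_hom_ext (by rw [← f.w₁, ← g.w₁, h]) (by rw [← f.w₂, ← g.w₂, h]))

/-- `X` is an (internal) equivalence relation. -/
def isEquivalence : ObjectProperty (InternalPreorder C) := fun X =>
  ∃ s : X.rel ⟶ X.rel, s ≫ X.r₁ = X.r₂ ∧ s ≫ X.r₂ = X.r₁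

/-- `X` is an (internal) partial order: the intersection of the relation with its opposite is
contained in the diagonal. -/
def isPartialOrder : ObjectProperty (InternalPreorder C) := fun X =>
  ∀ ⦃T : C⦄ (x y : T ⟶ X.carrier), X.le x y → X.le y x → x = y

/-- The trivial objects (discrete preorders). -/
def isTrivial : ObjectProperty (InternalPreorder C) := isEquivalence ⊓ isPartialOrder

/-! ### Limits, colimits and complemented subobjects of internal preorders -/

/-- The initial internal preorder. -/
noncomputable def empty (C : Type u) [Category.{v} C] [IsPretopos C] : InternalPreorder C where
  carrier := ⊥_ C
  rel := ⊥_ C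
  r₁ := 𝟙 _
  r₂ := 𝟙 _
  jointlyMono := ⟨fun _ _ _ h _ => (cancel_mono (𝟙 _)).1 h⟩
  reflexive := ⟨𝟙 _, by simp, by simp⟩
  transitive := ⟨pullback.fst _ _, rfl, by
    rw [Category.comp_id, Category.comp_id]; exact initialIsInitial.strict_hom_ext _ _⟩

theorem isInitial_of_carrier {X : InternalPreorder C} (h : Nonempty (IsInitial X.carrier)) :
    Nonempty (IsInitial X) := by
  obtain ⟨h⟩ := h
  have h' : IsInitial X.rel := IsInitial.ofStrict X.r₁ h
  exact ⟨IsInitial.ofUniqueHom (fun Y => ⟨h.to _, h'.to _, h'.hom_ext _ _, h'.hom_ext _ _⟩)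
    (fun Y f => hom_ext (h.hom_ext _ _))⟩

theorem empty_isInitial : Nonempty (IsInitial (empty C)) :=
  isInitial_of_carrier ⟨initialIsInitial⟩

instance : HasInitial (InternalPreorder C) :=
  (empty_isInitial (C := C)).some.hasInitial

theorem carrier_of_isInitial {X : InternalPreorder C} (h : IsInitial X) :
    Nonempty (IsInitial X.carrier) :=
  ⟨IsInitial.ofStrict (h.to (empty C)).base initialIsInitial⟩

instance : HasStrictInitialObjects (InternalPreorder C) where
  out {I A} f hI := by
    obtain ⟨h⟩ := carrier_of_isInitial hI
    obtain ⟨hA⟩ := isInitial_of_carrier (X := A) ⟨IsInitial.ofStrict f.base h⟩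
    exact ⟨hI.to A, hA.hom_ext _ _, hI.hom_ext _ _⟩

/-- The discrete preorder. -/
noncomputable def discrete (T : C) : InternalPreorder C where
  carrier := T
  rel := T
  r₁ := 𝟙 _
  r₂ := 𝟙 _
  jointlyMono := ⟨fun _ _ _ h _ => (cancel_mono (𝟙 _)).1 h⟩
  reflexive := ⟨𝟙 _, by simp, by simp⟩
  transitive := ⟨pullback.fst _ _, rfl, by simpa using pullback.condition (f := 𝟙 T) (g := 𝟙 T)⟩

/-- A generalized element as a morphism from a discrete preorder. -/
theorem exists_ofElement (X : InternalPreorder C) {T : C} (x : T ⟶ X.carrier) :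
    ∃ f : discrete T ⟶ X, f.base = x := by
  obtain ⟨h, h₁, h₂⟩ := X.le_refl x
  exact ⟨⟨x, h, (Category.id_comp _).trans h₁.symm, (Category.id_comp _).trans h₂.symm⟩, rfl⟩

theorem mono_of_base {X Y : InternalPreorder C} (f : X ⟶ Y) (h : Mono f.base) : Mono f :=
  ⟨fun _ _ e => hom_ext ((cancel_mono f.base).1 (congrArg Hom.base e))⟩

theorem mono_base {X Y : InternalPreorder C} (f : X ⟶ Y) [Mono f] : Mono f.base := by
  refine ⟨fun {T} x y e => ?_⟩
  obtain ⟨x', rfl⟩ := X.exists_ofElement x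
  obtain ⟨y', rfl⟩ := X.exists_ofElement y
  have : x' ≫ f = y' ≫ f := hom_ext e
  rw [(cancel_mono f).1 this]

theorem mono_rel_of_base {X Y : InternalPreorder C} (f : X ⟶ Y) (h : Mono f.base) :
    Mono f.rel := by
  refine ⟨fun {T} x y e => X.rel_hom_ext ?_ ?_⟩
  · rw [← cancel_mono f.base, Category.assoc, Category.assoc, f.w₁, ← Category.assoc, e,
      Category.assoc]
  · rw [← cancel_mono f.base, Category.assoc, Category.assoc, f.w₂, ← Category.assoc, e,
      Category.assoc]

theorem isIso_of_base_rel {X Y : InternalPreorder C} (f : X ⟶ Y) [IsIso f.base] [IsIso f.rel] :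
    IsIso f := by
  refine ⟨⟨inv f.base, inv f.rel, ?_, ?_⟩, hom_ext ?_, hom_ext ?_⟩
  · rw [IsIso.comp_inv_eq, Category.assoc, f.w₁, IsIso.inv_hom_id_assoc]
  · rw [IsIso.comp_inv_eq, Category.assoc, f.w₂, IsIso.inv_hom_id_assoc]
  · exact IsIso.hom_inv_id f.base
  · exact IsIso.inv_hom_id f.base

instance isIso_base {X Y : InternalPreorder C} (f : X ⟶ Y) [IsIso f] : IsIso f.base :=
  ⟨(inv f).base, by rw [← comp_base, IsIso.hom_inv_id, id_base],
    by rw [← comp_base, IsIso.inv_hom_id, id_base]⟩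

instance isIso_rel {X Y : InternalPreorder C} (f : X ⟶ Y) [IsIso f] : IsIso f.rel :=
  ⟨(inv f).rel, by rw [← comp_rel, IsIso.hom_inv_id, id_rel],
    by rw [← comp_rel, IsIso.inv_hom_id, id_rel]⟩

section Pullback

variable {X Y Z : InternalPreorder C} (f : X ⟶ Z) (g : Y ⟶ Z)

/-- The pullback of internal preorders, computed componentwise. -/
noncomputable def pb : InternalPreorder C where
  carrier := pullback f.base g.base
  rel := pullback f.rel g.rel
  r₁ := pullback.map _ _ _ _ X.r₁ Y.r₁ Z.r₁ f.w₁.symm g.w₁.symm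
  r₂ := pullback.map _ _ _ _ X.r₂ Y.r₂ Z.r₂ f.w₂.symm g.w₂.symm
  jointlyMono := by
    refine ⟨fun {T} a b h₁ h₂ => pullback.hom_ext (X.rel_hom_ext ?_ ?_) (Y.rel_hom_ext ?_ ?_)⟩
    · simpa [pullback.lift_fst] using congrArg (· ≫ pullback.fst _ _) h₁
    · simpa [pullback.lift_fst] using congrArg (· ≫ pullback.fst _ _) h₂
    · simpa [pullback.lift_snd] using congrArg (· ≫ pullback.snd _ _) h₁
    · simpa [pullback.lift_snd] using congrArg (· ≫ pullback.snd _ _) h₂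
  reflexive := by
    obtain ⟨h, h₁, h₂⟩ := X.le_refl (pullback.fst f.base g.base)
    obtain ⟨k, k₁, k₂⟩ := Y.le_refl (pullback.snd f.base g.base)
    refine ⟨pullback.lift h k (Z.rel_hom_ext ?_ ?_), pullback.hom_ext ?_ ?_,
      pullback.hom_ext ?_ ?_⟩
    · rw [Category.assoc, Category.assoc, ← f.w₁, ← g.w₁, ← Category.assoc, ← Category.assoc, h₁,
        k₁, pullback.condition]
    · rw [Category.assoc, Category.assoc, ← f.w₂, ← g.w₂, ← Category.assoc, ← Category.assoc, h₂,
        k₂, pullback.condition]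
    · simp [pullback.lift_fst, pullback.lift_fst_assoc, h₁]
    · simp [pullback.lift_snd, pullback.lift_snd_assoc, k₁]
    · simp [pullback.lift_fst, pullback.lift_fst_assoc, h₂]
    · simp [pullback.lift_snd, pullback.lift_snd_assoc, k₂]
  transitive := by
    generalize hs₁ : pullback.map f.rel g.rel f.base g.base X.r₁ Y.r₁ Z.r₁ f.w₁.symm g.w₁.symm = s₁
    generalize hs₂ : pullback.map f.rel g.rel f.base g.base X.r₂ Y.r₂ Z.r₂ f.w₂.symm g.w₂.symm = s₂
    have a₁ : s₁ ≫ pullback.fst _ _ = pullback.fst _ _ ≫ X.r₁ := by rw [← hs₁, pullback.lift_fst]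
    have b₁ : s₁ ≫ pullback.snd _ _ = pullback.snd _ _ ≫ Y.r₁ := by rw [← hs₁, pullback.lift_snd]
    have a₂ : s₂ ≫ pullback.fst _ _ = pullback.fst _ _ ≫ X.r₂ := by rw [← hs₂, pullback.lift_fst]
    have b₂ : s₂ ≫ pullback.snd _ _ = pullback.snd _ _ ≫ Y.r₂ := by rw [← hs₂, pullback.lift_snd]
    have c := pullback.condition (f := s₂) (g := s₁)
    have cX := congrArg (· ≫ pullback.fst _ _) c
    have cY := congrArg (· ≫ pullback.snd _ _) c
    simp only [Category.assoc, a₁, a₂, b₁, b₂] at cX cY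
    obtain ⟨h, h₁, h₂⟩ := X.le_trans
      (x := pullback.fst s₂ s₁ ≫ pullback.fst _ _ ≫ X.r₁)
      (z := pullback.snd s₂ s₁ ≫ pullback.fst _ _ ≫ X.r₂)
      ⟨pullback.fst s₂ s₁ ≫ pullback.fst _ _, by simp, by simpa using cX⟩
      ⟨pullback.snd s₂ s₁ ≫ pullback.fst _ _, by simp, by simp⟩
    obtain ⟨k, k₁, k₂⟩ := Y.le_trans
      (x := pullback.fst s₂ s₁ ≫ pullback.snd _ _ ≫ Y.r₁)
      (z := pullback.snd s₂ s₁ ≫ pullback.snd _ _ ≫ Y.r₂)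
      ⟨pullback.fst s₂ s₁ ≫ pullback.snd _ _, by simp, by simpa using cY⟩
      ⟨pullback.snd s₂ s₁ ≫ pullback.snd _ _, by simp, by simp⟩
    refine ⟨pullback.lift h k (Z.rel_hom_ext ?_ ?_), pullback.hom_ext ?_ ?_,
      pullback.hom_ext ?_ ?_⟩
    · rw [Category.assoc, Category.assoc, ← f.w₁, ← g.w₁, ← Category.assoc, ← Category.assoc, h₁,
        k₁]
      simp only [Category.assoc, f.w₁, g.w₁]
      rw [pullback.condition_assoc]
    · rw [Category.assoc, Category.assoc, ← f.w₂, ← g.w₂, ← Category.assoc, ← Category.assoc, h₂,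
        k₂]
      simp only [Category.assoc, f.w₂, g.w₂]
      rw [pullback.condition_assoc]
    · simp [a₁, h₁, pullback.lift_fst_assoc]
    · simp [b₁, k₁, pullback.lift_snd_assoc]
    · simp [a₂, h₂, pullback.lift_fst_assoc]
    · simp [b₂, k₂, pullback.lift_snd_assoc]

/-- The first projection of the pullback. -/
noncomputable def pbFst : pb f g ⟶ X where
  base := pullback.fst f.base g.base
  rel := pullback.fst f.rel g.rel
  w₁ := pullback.lift_fst _ _ _
  w₂ := pullback.lift_fst _ _ _

/-- The second projection of the pullback. -/
noncomputable def pbSnd : pb f g ⟶ Y where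
  base := pullback.snd f.base g.base
  rel := pullback.snd f.rel g.rel
  w₁ := pullback.lift_snd _ _ _
  w₂ := pullback.lift_snd _ _ _

theorem pb_condition : pbFst f g ≫ f = pbSnd f g ≫ g := hom_ext pullback.condition

theorem pb_isPullback : IsPullback (pbFst f g) (pbSnd f g) f g := by
  refine ⟨⟨pb_condition f g⟩, ⟨PullbackCone.IsLimit.mk _
    (fun s => ⟨pullback.lift s.fst.base s.snd.base (congrArg Hom.base s.condition),
      pullback.lift s.fst.rel s.snd.rel (congrArg Hom.rel s.condition), ?_, ?_⟩)
    (fun s => hom_ext ?_) (fun s => hom_ext ?_) (fun s m h₁ h₂ => hom_ext ?_)⟩⟩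
  · apply pullback.hom_ext
    · simp [pb, pullback.lift_fst, pullback.lift_fst_assoc, s.fst.w₁]
    · simp [pb, pullback.lift_snd, pullback.lift_snd_assoc, s.snd.w₁]
  · apply pullback.hom_ext
    · simp [pb, pullback.lift_fst, pullback.lift_fst_assoc, s.fst.w₂]
    · simp [pb, pullback.lift_snd, pullback.lift_snd_assoc, s.snd.w₂]
  · exact pullback.lift_fst _ _ _
  · exact pullback.lift_snd _ _ _
  · apply pullback.hom_ext
    · exact (congrArg Hom.base h₁).trans (pullback.lift_fst _ _ _).symm
    · exact (congrArg Hom.base h₂).trans (pullback.lift_snd _ _ _).symm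

end Pullback

section Coproduct

theorem le_of_isSum (Z : InternalPreorder C) {T₁ T₂ T : C} {i₁ : T₁ ⟶ T} {i₂ : T₂ ⟶ T}
    (h : IsSum i₁ i₂) {x y : T ⟶ Z.carrier} (h₁ : Z.le (i₁ ≫ x) (i₁ ≫ y))
    (h₂ : Z.le (i₂ ≫ x) (i₂ ≫ y)) : Z.le x y := by
  obtain ⟨k₁, a₁, b₁⟩ := h₁
  obtain ⟨k₂, a₂, b₂⟩ := h₂
  obtain ⟨d, e₁, e₂⟩ := h.exists_desc k₁ k₂
  exact ⟨d, h.hom_ext (by rw [← Category.assoc, e₁, a₁]) (by rw [← Category.assoc, e₂, a₂]),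
    h.hom_ext (by rw [← Category.assoc, e₁, b₁]) (by rw [← Category.assoc, e₂, b₂])⟩

variable (X Y : InternalPreorder C)

theorem sum_transitive {T : C} (h k : T ⟶ X.rel ⨿ Y.rel)
    (e : h ≫ coprod.map X.r₂ Y.r₂ = k ≫ coprod.map X.r₁ Y.r₁) :
    ∃ t : T ⟶ X.rel ⨿ Y.rel, t ≫ coprod.map X.r₁ Y.r₁ = h ≫ coprod.map X.r₁ Y.r₁ ∧
      t ≫ coprod.map X.r₂ Y.r₂ = k ≫ coprod.map X.r₂ Y.r₂ := by
  have hR := IsSum.coprod X.rel Y.rel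
  have hC := IsSum.coprod X.carrier Y.carrier
  have m₁ := hC.mono_inl
  have m₂ := hC.mono_inr
  have glue : ∀ {T₁ T₂ T : C} {i₁ : T₁ ⟶ T} {i₂ : T₂ ⟶ T} (_ : IsSum i₁ i₂)
      (h k : T ⟶ X.rel ⨿ Y.rel),
      (∃ t : T₁ ⟶ X.rel ⨿ Y.rel, t ≫ coprod.map X.r₁ Y.r₁ = (i₁ ≫ h) ≫ coprod.map X.r₁ Y.r₁ ∧
        t ≫ coprod.map X.r₂ Y.r₂ = (i₁ ≫ k) ≫ coprod.map X.r₂ Y.r₂) →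
      (∃ t : T₂ ⟶ X.rel ⨿ Y.rel, t ≫ coprod.map X.r₁ Y.r₁ = (i₂ ≫ h) ≫ coprod.map X.r₁ Y.r₁ ∧
        t ≫ coprod.map X.r₂ Y.r₂ = (i₂ ≫ k) ≫ coprod.map X.r₂ Y.r₂) →
      ∃ t : T ⟶ X.rel ⨿ Y.rel, t ≫ coprod.map X.r₁ Y.r₁ = h ≫ coprod.map X.r₁ Y.r₁ ∧
        t ≫ coprod.map X.r₂ Y.r₂ = k ≫ coprod.map X.r₂ Y.r₂ := by
    rintro T₁ T₂ T i₁ i₂ hi h k ⟨t₁, a₁, b₁⟩ ⟨t₂, a₂, b₂⟩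
    obtain ⟨d, e₁, e₂⟩ := hi.exists_desc t₁ t₂
    exact ⟨d,
      hi.hom_ext (by rw [← Category.assoc, e₁, a₁, Category.assoc])
        (by rw [← Category.assoc, e₂, a₂, Category.assoc]),
      hi.hom_ext (by rw [← Category.assoc, e₁, b₁, Category.assoc])
        (by rw [← Category.assoc, e₂, b₂, Category.assoc])⟩
  have LL : ∀ {T : C} (h k : T ⟶ X.rel ⨿ Y.rel) (h₀ k₀ : T ⟶ X.rel), h = h₀ ≫ coprod.inl →
      k = k₀ ≫ coprod.inl → h ≫ coprod.map X.r₂ Y.r₂ = k ≫ coprod.map X.r₁ Y.r₁ →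
      ∃ t : T ⟶ X.rel ⨿ Y.rel, t ≫ coprod.map X.r₁ Y.r₁ = h ≫ coprod.map X.r₁ Y.r₁ ∧
        t ≫ coprod.map X.r₂ Y.r₂ = k ≫ coprod.map X.r₂ Y.r₂ := by
    rintro T _ _ h₀ k₀ rfl rfl e
    simp only [Category.assoc, coprod.inl_map] at e
    rw [← Category.assoc, ← Category.assoc, cancel_mono] at e
    obtain ⟨t, a, b⟩ := X.le_trans (x := h₀ ≫ X.r₁) (z := k₀ ≫ X.r₂) ⟨h₀, rfl, rfl⟩
      ⟨k₀, e.symm, rfl⟩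
    exact ⟨t ≫ coprod.inl, by simp [reassoc_of% a], by simp [reassoc_of% b]⟩
  have RR : ∀ {T : C} (h k : T ⟶ X.rel ⨿ Y.rel) (h₀ k₀ : T ⟶ Y.rel), h = h₀ ≫ coprod.inr →
      k = k₀ ≫ coprod.inr → h ≫ coprod.map X.r₂ Y.r₂ = k ≫ coprod.map X.r₁ Y.r₁ →
      ∃ t : T ⟶ X.rel ⨿ Y.rel, t ≫ coprod.map X.r₁ Y.r₁ = h ≫ coprod.map X.r₁ Y.r₁ ∧
        t ≫ coprod.map X.r₂ Y.r₂ = k ≫ coprod.map X.r₂ Y.r₂ := by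
    rintro T _ _ h₀ k₀ rfl rfl e
    simp only [Category.assoc, coprod.inr_map] at e
    rw [← Category.assoc, ← Category.assoc, cancel_mono] at e
    obtain ⟨t, a, b⟩ := Y.le_trans (x := h₀ ≫ Y.r₁) (z := k₀ ≫ Y.r₂) ⟨h₀, rfl, rfl⟩
      ⟨k₀, e.symm, rfl⟩
    exact ⟨t ≫ coprod.inr, by simp [reassoc_of% a], by simp [reassoc_of% b]⟩
  have LR : ∀ {T : C} (h k : T ⟶ X.rel ⨿ Y.rel) (h₀ : T ⟶ X.rel) (k₀ : T ⟶ Y.rel),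
      h = h₀ ≫ coprod.inl → k = k₀ ≫ coprod.inr →
      h ≫ coprod.map X.r₂ Y.r₂ = k ≫ coprod.map X.r₁ Y.r₁ →
      ∃ t : T ⟶ X.rel ⨿ Y.rel, t ≫ coprod.map X.r₁ Y.r₁ = h ≫ coprod.map X.r₁ Y.r₁ ∧
        t ≫ coprod.map X.r₂ Y.r₂ = k ≫ coprod.map X.r₂ Y.r₂ := by
    rintro T _ _ h₀ k₀ rfl rfl e
    obtain ⟨hI⟩ := hC.disjoint (h₀ ≫ X.r₂) (k₀ ≫ Y.r₁) (by simpa using e)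
    exact ⟨h₀ ≫ coprod.inl, hI.hom_ext _ _, hI.hom_ext _ _⟩
  have RL : ∀ {T : C} (h k : T ⟶ X.rel ⨿ Y.rel) (h₀ : T ⟶ Y.rel) (k₀ : T ⟶ X.rel),
      h = h₀ ≫ coprod.inr → k = k₀ ≫ coprod.inl →
      h ≫ coprod.map X.r₂ Y.r₂ = k ≫ coprod.map X.r₁ Y.r₁ →
      ∃ t : T ⟶ X.rel ⨿ Y.rel, t ≫ coprod.map X.r₁ Y.r₁ = h ≫ coprod.map X.r₁ Y.r₁ ∧
        t ≫ coprod.map X.r₂ Y.r₂ = k ≫ coprod.map X.r₂ Y.r₂ := by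
    rintro T _ _ h₀ k₀ rfl rfl e
    obtain ⟨hI⟩ := hC.disjoint (k₀ ≫ X.r₁) (h₀ ≫ Y.r₂) (by simpa using e.symm)
    exact ⟨h₀ ≫ coprod.inr, hI.hom_ext _ _, hI.hom_ext _ _⟩
  have hl := pullback.condition (f := h) (g := (coprod.inl : X.rel ⟶ X.rel ⨿ Y.rel))
  have hr := pullback.condition (f := h) (g := (coprod.inr : Y.rel ⟶ X.rel ⨿ Y.rel))
  refine glue (hR.pullback h) h k
    (glue (hR.pullback (pullback.fst h coprod.inl ≫ k)) _ _ ?_ ?_)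
    (glue (hR.pullback (pullback.fst h coprod.inr ≫ k)) _ _ ?_ ?_)
  · refine LL _ _ _ _ (by rw [hl, ← Category.assoc]) pullback.condition ?_
    simp only [Category.assoc, e]
  · refine LR _ _ _ _ (by rw [hl, ← Category.assoc]) pullback.condition ?_
    simp only [Category.assoc, e]
  · refine RL _ _ _ _ (by rw [hr, ← Category.assoc]) pullback.condition ?_
    simp only [Category.assoc, e]
  · refine RR _ _ _ _ (by rw [hr, ← Category.assoc]) pullback.condition ?_
    simp only [Category.assoc, e]

/-- The coproduct of internal preorders, computed componentwise. -/
noncomputable def sum : InternalPreorder C where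
  carrier := X.carrier ⨿ Y.carrier
  rel := X.rel ⨿ Y.rel
  r₁ := coprod.map X.r₁ Y.r₁
  r₂ := coprod.map X.r₂ Y.r₂
  jointlyMono := by
    have hR := IsSum.coprod X.rel Y.rel
    have hC := IsSum.coprod X.carrier Y.carrier
    have m₁ := hC.mono_inl
    have m₂ := hC.mono_inr
    refine ⟨fun {T} f g e₁ e₂ => (hR.pullback f).hom_ext ?_ ?_⟩
    · have c := pullback.condition (f := f) (g := (coprod.inl : X.rel ⟶ X.rel ⨿ Y.rel))
      refine (hR.pullback (pullback.fst f coprod.inl ≫ g)).hom_ext ?_ ?_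
      · have d := pullback.condition (f := pullback.fst f coprod.inl ≫ g)
          (g := (coprod.inl : X.rel ⟶ X.rel ⨿ Y.rel))
        rw [d, c, ← Category.assoc]
        congr 1
        apply X.rel_hom_ext
        · rw [← cancel_mono (coprod.inl : X.carrier ⟶ X.carrier ⨿ Y.carrier)]
          simp only [Category.assoc, ← coprod.inl_map X.r₁ Y.r₁]
          rw [← reassoc_of% c, ← reassoc_of% d, e₁]
        · rw [← cancel_mono (coprod.inl : X.carrier ⟶ X.carrier ⨿ Y.carrier)]
          simp only [Category.assoc, ← coprod.inl_map X.r₂ Y.r₂]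
          rw [← reassoc_of% c, ← reassoc_of% d, e₂]
      · have d := pullback.condition (f := pullback.fst f coprod.inl ≫ g)
          (g := (coprod.inr : Y.rel ⟶ X.rel ⨿ Y.rel))
        obtain ⟨hI⟩ := hC.disjoint
          (pullback.fst (pullback.fst f coprod.inl ≫ g) coprod.inr ≫ pullback.snd _ _ ≫ X.r₁)
          (pullback.snd _ _ ≫ Y.r₁) (by
            simp only [Category.assoc, ← coprod.inl_map X.r₁ Y.r₁, ← coprod.inr_map X.r₁ Y.r₁]
            rw [← reassoc_of% c, ← reassoc_of% d, e₁])
        exact hI.hom_ext _ _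
    · have c := pullback.condition (f := f) (g := (coprod.inr : Y.rel ⟶ X.rel ⨿ Y.rel))
      refine (hR.pullback (pullback.fst f coprod.inr ≫ g)).hom_ext ?_ ?_
      · have d := pullback.condition (f := pullback.fst f coprod.inr ≫ g)
          (g := (coprod.inl : X.rel ⟶ X.rel ⨿ Y.rel))
        obtain ⟨hI⟩ := hC.disjoint (pullback.snd _ _ ≫ X.r₁)
          (pullback.fst (pullback.fst f coprod.inr ≫ g) coprod.inl ≫ pullback.snd _ _ ≫ Y.r₁) (by
            simp only [Category.assoc, ← coprod.inl_map X.r₁ Y.r₁, ← coprod.inr_map X.r₁ Y.r₁]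
            rw [← reassoc_of% c, ← reassoc_of% d, e₁])
        exact hI.hom_ext _ _
      · have d := pullback.condition (f := pullback.fst f coprod.inr ≫ g)
          (g := (coprod.inr : Y.rel ⟶ X.rel ⨿ Y.rel))
        rw [d, c, ← Category.assoc]
        congr 1
        apply Y.rel_hom_ext
        · rw [← cancel_mono (coprod.inr : Y.carrier ⟶ X.carrier ⨿ Y.carrier)]
          simp only [Category.assoc, ← coprod.inr_map X.r₁ Y.r₁]
          rw [← reassoc_of% c, ← reassoc_of% d, e₁]
        · rw [← cancel_mono (coprod.inr : Y.carrier ⟶ X.carrier ⨿ Y.carrier)]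
          simp only [Category.assoc, ← coprod.inr_map X.r₂ Y.r₂]
          rw [← reassoc_of% c, ← reassoc_of% d, e₂]
  reflexive := by
    obtain ⟨e, h₁, h₂⟩ := X.reflexive
    obtain ⟨e', h₁', h₂'⟩ := Y.reflexive
    exact ⟨coprod.map e e', by rw [coprod.map_map, h₁, h₁', coprod.map_id_id],
      by rw [coprod.map_map, h₂, h₂', coprod.map_id_id]⟩
  transitive := sum_transitive X Y _ _ pullback.condition

/-- The first coprojection. -/
noncomputable def inl : X ⟶ sum X Y where
  base := coprod.inl
  rel := coprod.inl
  w₁ := (coprod.inl_map _ _).symm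
  w₂ := (coprod.inl_map _ _).symm

/-- The second coprojection. -/
noncomputable def inr : Y ⟶ sum X Y where
  base := coprod.inr
  rel := coprod.inr
  w₁ := (coprod.inr_map _ _).symm
  w₂ := (coprod.inr_map _ _).symm

variable {X Y}

theorem isSum_of_base_rel {Z : InternalPreorder C} {i : X ⟶ Z} {j : Y ⟶ Z}
    (hb : IsSum i.base j.base) (hr : IsSum i.rel j.rel) : IsSum i j := by
  refine IsSum.of_desc (fun {W} f g => ?_) (fun f g h₁ h₂ => hom_ext ?_)
  · obtain ⟨d, hd₁, hd₂⟩ := hb.exists_desc f.base g.base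
    obtain ⟨e, he₁, he₂⟩ := hr.exists_desc f.rel g.rel
    refine ⟨⟨d, e, hr.hom_ext ?_ ?_, hr.hom_ext ?_ ?_⟩, hom_ext hd₁, hom_ext hd₂⟩
    · rw [← Category.assoc, ← i.w₁, Category.assoc, hd₁, f.w₁, ← Category.assoc, he₁]
    · rw [← Category.assoc, ← j.w₁, Category.assoc, hd₂, g.w₁, ← Category.assoc, he₂]
    · rw [← Category.assoc, ← i.w₂, Category.assoc, hd₁, f.w₂, ← Category.assoc, he₁]
    · rw [← Category.assoc, ← j.w₂, Category.assoc, hd₂, g.w₂, ← Category.assoc, he₂]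
  · exact hb.hom_ext (congrArg Hom.base h₁) (congrArg Hom.base h₂)

theorem isSum_inl_inr : IsSum (inl X Y) (inr X Y) :=
  isSum_of_base_rel (IsSum.coprod _ _) (IsSum.coprod _ _)

instance : HasBinaryCoproducts (InternalPreorder C) :=
  have (X Y : InternalPreorder C) : HasBinaryCoproduct X Y :=
    HasColimit.mk ⟨_, (isSum_inl_inr (X := X) (Y := Y)).some⟩
  hasBinaryCoproducts_of_hasColimit_pair _

instance : HasFiniteCoproducts (InternalPreorder C) :=
  hasFiniteCoproducts_of_has_binary_and_initial

end Coproduct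

/-! ### Complemented subobjects -/

/-- `α` and `β` represent complementary subobjects of `X`: their intersection is the initial
subobject and their union is `X`. -/
def AreComplements {A B X : InternalPreorder C} (α : A ⟶ X) (β : B ⟶ X) : Prop :=
  ∃ (_ : Mono α) (_ : Mono β), IsCompl (Subobject.mk α) (Subobject.mk β)

/-- `α` represents a complemented subobject of `X`. -/
def IsComplemented {A X : InternalPreorder C} (α : A ⟶ X) : Prop :=
  ∃ (B : InternalPreorder C) (β : B ⟶ X), AreComplements α β

theorem IsComplemented.mono {A X : InternalPreorder C} {α : A ⟶ X} (h : IsComplemented α) :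
    Mono α := by
  obtain ⟨_, _, h, _⟩ := h
  exact h

variable {A B X Y : InternalPreorder C}

theorem areComplements_of_isSum {α : A ⟶ X} {β : B ⟶ X} (hb : IsSum α.base β.base)
    (hr : IsSum α.rel β.rel) : AreComplements α β := by
  have mα := mono_of_base α hb.mono_inl
  have mβ := mono_of_base β hb.mono_inr
  refine ⟨mα, mβ, fun x hα hβ => ?_, fun x hα hβ => ?_⟩
  · have e : Subobject.ofLEMk x α hα ≫ α = Subobject.ofLEMk x β hβ ≫ β := by
      rw [Subobject.ofLEMk_comp, Subobject.ofLEMk_comp]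
    obtain ⟨hI⟩ := isInitial_of_carrier (hb.disjoint _ _ (congrArg Hom.base e))
    exact Subobject.le_of_comm (hI.to _) (hI.hom_ext _ _)
  · have eα := Subobject.ofMkLE_arrow (h := hα)
    have eβ := Subobject.ofMkLE_arrow (h := hβ)
    have mx := mono_base x.arrow
    have mx' := mono_rel_of_base x.arrow mx
    have := hb.isIso_of_mono x.arrow.base _ _ (congrArg Hom.base eα) (congrArg Hom.base eβ)
    have := hr.isIso_of_mono x.arrow.rel _ _ (congrArg Hom.rel eα) (congrArg Hom.rel eβ)
    have := isIso_of_base_rel x.arrow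
    rw [Subobject.eq_top_of_isIso_arrow x]

theorem AreComplements.disjoint {α : A ⟶ X} {β : B ⟶ X} (h : AreComplements α β)
    {T : InternalPreorder C} (x : T ⟶ A) (y : T ⟶ B) (e : x ≫ α = y ≫ β) :
    Nonempty (IsInitial T) := by
  obtain ⟨mα, mβ, hd, -⟩ := h
  have mf : Mono (pbFst α β) := by
    refine ⟨fun a b e => (pb_isPullback α β).hom_ext e ?_⟩
    rw [← cancel_mono β, Category.assoc, Category.assoc, ← pb_condition, reassoc_of% e]
  have mm : Mono (pbFst α β ≫ α) := mono_comp _ _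
  have hle := hd (x := Subobject.mk (pbFst α β ≫ α))
    (Subobject.mk_le_mk_of_comm (pbFst α β) rfl)
    (Subobject.mk_le_mk_of_comm (pbSnd α β) (pb_condition α β).symm)
  rw [Subobject.bot_eq_initial_to] at hle
  exact ⟨IsInitial.ofStrict ((pb_isPullback α β).lift x y e ≫ Subobject.ofMkLEMk _ _ hle)
    initialIsInitial⟩

theorem AreComplements.isSum_base_rel {α : A ⟶ X} {β : B ⟶ X} (h : AreComplements α β) :
    IsSum α.base β.base ∧ IsSum α.rel β.rel := by
  obtain ⟨mα, mβ, -, hc⟩ := id h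
  obtain ⟨d, hd₁, hd₂⟩ := (isSum_inl_inr (X := A) (Y := B)).exists_desc α β
  have e₁ : coprod.inl ≫ d.base = α.base := congrArg Hom.base hd₁
  have e₂ : coprod.inr ≫ d.base = β.base := congrArg Hom.base hd₂
  have md : Mono d := by
    refine mono_of_base d ((IsSum.coprod A.carrier B.carrier).mono_of_disjoint d.base
      (e₁ ▸ mono_base α) (e₂ ▸ mono_base β) (fun {T} x y e => ?_))
    obtain ⟨x', rfl⟩ := A.exists_ofElement x
    obtain ⟨y', rfl⟩ := B.exists_ofElement y
    obtain ⟨hI⟩ := h.disjoint x' y' (hom_ext (by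
      refine Eq.trans ?_ (e.trans ?_)
      · exact congrArg (x'.base ≫ ·) e₁.symm
      · exact congrArg (y'.base ≫ ·) e₂))
    exact carrier_of_isInitial hI
  have hle := hc (x := Subobject.mk d) (Subobject.mk_le_mk_of_comm (inl A B) hd₁)
    (Subobject.mk_le_mk_of_comm (inr A B) hd₂)
  have hiso : IsIso d := (Subobject.isIso_iff_mk_eq_top d).2 (top_le_iff.1 hle)
  have f₁ : coprod.inl ≫ d.rel = α.rel := congrArg Hom.rel hd₁
  have f₂ : coprod.inr ≫ d.rel = β.rel := congrArg Hom.rel hd₂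
  have := (IsSum.coprod A.carrier B.carrier).comp_iso d.base (isIso_base d)
  have := (IsSum.coprod A.rel B.rel).comp_iso d.rel (isIso_rel d)
  rw [← e₁, ← e₂, ← f₁, ← f₂]
  constructor <;> assumption

theorem AreComplements.pullback {α : A ⟶ X} {β : B ⟶ X} (h : AreComplements α β) (f : Y ⟶ X) :
    AreComplements (pbFst f α) (pbFst f β) :=
  areComplements_of_isSum (h.isSum_base_rel.1.pullback f.base) (h.isSum_base_rel.2.pullback f.rel)

theorem IsComplemented.pullback {α : A ⟶ X} (h : IsComplemented α) (f : Y ⟶ X) :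
    IsComplemented (pbFst f α) := by
  obtain ⟨B, β, h⟩ := h
  exact ⟨_, _, h.pullback f⟩

theorem IsComplemented.of_isIso (α : A ⟶ X) [IsIso α] : IsComplemented α :=
  ⟨⊥_ _, initial.to X, areComplements_of_isSum
    (IsSum.of_isIso (carrier_of_isInitial initialIsInitial).some _)
    (IsSum.of_isIso (IsInitial.ofStrict (⊥_ (InternalPreorder C)).r₁
      (carrier_of_isInitial initialIsInitial).some) _)⟩

theorem IsComplemented.comp {β : B ⟶ A} {α : A ⟶ X} (hβ : IsComplemented β)
    (hα : IsComplemented α) : IsComplemented (β ≫ α) := by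
  obtain ⟨A', α', hα⟩ := hα
  obtain ⟨B', β', hβ⟩ := hβ
  obtain ⟨d, hd₁, hd₂⟩ := (isSum_inl_inr (X := B') (Y := A')).exists_desc (β' ≫ α) α'
  exact ⟨sum B' A', d, areComplements_of_isSum
    (hα.isSum_base_rel.1.assoc hβ.isSum_base_rel.1 (IsSum.coprod _ _) d.base
      (congrArg Hom.base hd₁) (congrArg Hom.base hd₂))
    (hα.isSum_base_rel.2.assoc hβ.isSum_base_rel.2 (IsSum.coprod _ _) d.rel
      (congrArg Hom.rel hd₁) (congrArg Hom.rel hd₂))⟩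

theorem IsComplemented.initial_to {I : InternalPreorder C} (hI : IsInitial I) (f : I ⟶ X) :
    IsComplemented f := by
  obtain ⟨hc⟩ := carrier_of_isInitial hI
  have hr : IsInitial I.rel := IsInitial.ofStrict I.r₁ hc
  have h : AreComplements (𝟙 X) f :=
    areComplements_of_isSum (IsSum.of_isIso hc f.base) (IsSum.of_isIso hr f.rel)
  obtain ⟨m₁, m₂, h⟩ := h
  exact ⟨X, 𝟙 X, m₂, m₁, h.symm⟩

end InternalPreorder

/-! ## Partial maps and the stable category -/

open InternalPreorder

/-- A representative of a partial map `X ⇀ Y`: a complemented subobject `ι : dom ⟶ X` together with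
a morphism `dom ⟶ Y`. -/
structure PartialMap {C : Type u} [Category.{v} C] [IsPretopos C] (X Y : InternalPreorder C) where
  dom : InternalPreorder C
  ι : dom ⟶ X
  complemented : IsComplemented ι
  map : dom ⟶ Y

namespace PartialMap

variable {C : Type u} [Category.{v} C] [IsPretopos C] {X Y Z W : InternalPreorder C}

/-- Two representatives define the same partial map if they differ by an isomorphism of domains. -/
def setoid (X Y : InternalPreorder C) : Setoid (PartialMap X Y) where
  r p q := ∃ e : p.dom ≅ q.dom, e.hom ≫ q.ι = p.ι ∧ e.hom ≫ q.map = p.map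
  iseqv :=
    { refl := fun p => ⟨Iso.refl _, by simp, by simp⟩
      symm := by
        rintro p q ⟨e, h₁, h₂⟩
        exact ⟨e.symm, by simp [← h₁], by simp [← h₂]⟩
      trans := by
        rintro p q r ⟨e, h₁, h₂⟩ ⟨e', h₁', h₂'⟩
        exact ⟨e ≪≫ e', by simp [h₁', h₁], by simp [h₂', h₂]⟩ }

/-- A morphism of internal preorders as an everywhere defined partial map. -/
def ofHom (f : X ⟶ Y) : PartialMap X Y := ⟨X, 𝟙 X, IsComplemented.of_isIso _, f⟩

/-- The composite of two partial maps, by pullback. -/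
noncomputable def comp (p : PartialMap X Y) (q : PartialMap Y Z) : PartialMap X Z where
  dom := pb p.map q.ι
  ι := pbFst p.map q.ι ≫ p.ι
  complemented := (q.complemented.pullback p.map).comp p.complemented
  map := pbSnd p.map q.ι ≫ q.map

theorem comp_rel_of_isPullback (p : PartialMap X Y) (q : PartialMap Y Z) (r : PartialMap X Z)
    (a : r.dom ⟶ p.dom) (b : r.dom ⟶ q.dom) (h : IsPullback a b p.map q.ι) (h₁ : a ≫ p.ι = r.ι)
    (h₂ : b ≫ q.map = r.map) : (setoid X Z).r (p.comp q) r :=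
  ⟨(pb_isPullback p.map q.ι).isoIsPullback _ _ h, by simp [comp, ← h₁], by simp [comp, ← h₂]⟩

theorem comp_congr {p p' : PartialMap X Y} {q q' : PartialMap Y Z} (hp : (setoid X Y).r p p')
    (hq : (setoid Y Z).r q q') : (setoid X Z).r (p.comp q) (p'.comp q') := by
  obtain ⟨e, h₁, h₂⟩ := hp
  obtain ⟨e', h₁', h₂'⟩ := hq
  refine (setoid X Z).iseqv.symm (comp_rel_of_isPullback p' q' (p.comp q)
    (pbFst p.map q.ι ≫ e.hom) (pbSnd p.map q.ι ≫ e'.hom) ?_ ?_ ?_)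
  · exact IsPullback.of_iso (pb_isPullback p.map q.ι) (Iso.refl _) e e' (Iso.refl _)
      (Category.id_comp _).symm (Category.id_comp _).symm (by simp [h₂]) (by simp [h₁'])
  · simp [comp, h₁]
  · simp [comp, h₂']

instance (f : X ⟶ Y) : IsIso (ofHom f).ι := inferInstanceAs (IsIso (𝟙 X))

instance : IsIso (ofHom (𝟙 X)).map := inferInstanceAs (IsIso (𝟙 X))

theorem id_comp (p : PartialMap X Y) : (setoid X Y).r ((ofHom (𝟙 X)).comp p) p :=
  comp_rel_of_isPullback _ _ _ p.ι (𝟙 _)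
    (IsPullback.of_vert_isIso ⟨by simp [ofHom]⟩) (by simp [ofHom]) (by simp)

theorem comp_id (p : PartialMap X Y) : (setoid X Y).r (p.comp (ofHom (𝟙 Y))) p :=
  comp_rel_of_isPullback _ _ _ (𝟙 _) p.map
    (IsPullback.of_horiz_isIso ⟨by simp [ofHom]⟩) (by simp) (by simp [ofHom])

theorem ofHom_comp (f : X ⟶ Y) (g : Y ⟶ Z) :
    (setoid X Z).r ((ofHom f).comp (ofHom g)) (ofHom (f ≫ g)) :=
  have h : IsPullback (𝟙 X) f f (𝟙 Y) := IsPullback.of_horiz_isIso ⟨by simp⟩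
  comp_rel_of_isPullback _ _ _ (𝟙 X) f h (by simp [ofHom]) (by simp [ofHom])

theorem assoc (p : PartialMap X Y) (q : PartialMap Y Z) (r : PartialMap Z W) :
    (setoid X W).r ((p.comp q).comp r) (p.comp (q.comp r)) := by
  have h₁ := pb_isPullback p.map q.ι
  have h₂ := pb_isPullback q.map r.ι
  have h₃ := pb_isPullback (pbSnd p.map q.ι) (pbFst q.map r.ι)
  refine (setoid X W).iseqv.trans (y :=
    ⟨pb (pbSnd p.map q.ι) (pbFst q.map r.ι), pbFst _ _ ≫ pbFst p.map q.ι ≫ p.ι,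
      ((r.complemented.pullback q.map).pullback _).comp
        ((q.complemented.pullback p.map).comp p.complemented),
      pbSnd _ _ ≫ pbSnd q.map r.ι ≫ r.map⟩) ?_ ((setoid X W).iseqv.symm ?_)
  · exact comp_rel_of_isPullback _ _ _ (pbFst _ _) (pbSnd _ _ ≫ pbSnd _ _)
      (h₃.paste_vert h₂) rfl (by simp)
  · exact comp_rel_of_isPullback _ _ _ (pbFst _ _ ≫ pbFst _ _) (pbSnd _ _)
      (h₃.paste_horiz h₁) (by simp) rfl

end PartialMap

/-- The category of internal preorders and partial maps (with complemented domain). -/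
structure PaPreOrd (C : Type u) [Category.{v} C] [IsPretopos C] where
  obj : InternalPreorder C

namespace PaPreOrd

variable {C : Type u} [Category.{v} C] [IsPretopos C]

noncomputable instance : Category (PaPreOrd C) where
  Hom X Y := Quotient (PartialMap.setoid X.obj Y.obj)
  id X := Quotient.mk _ (PartialMap.ofHom (𝟙 X.obj))
  comp f g := Quotient.map₂ PartialMap.comp
    (fun _ _ hp _ _ hq => PartialMap.comp_congr hp hq) f g
  id_comp f := Quotient.inductionOn f fun p => Quotient.sound (PartialMap.id_comp p)
  comp_id f := Quotient.inductionOn f fun p => Quotient.sound (PartialMap.comp_id p)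
  assoc f g h := Quotient.inductionOn₃ f g h fun p q r => Quotient.sound (PartialMap.assoc p q r)

/-- The partial map represented by `p`. -/
def homMk {X Y : PaPreOrd C} (p : PartialMap X.obj Y.obj) : X ⟶ Y := Quotient.mk _ p

theorem homMk_surjective {X Y : PaPreOrd C} (f : X ⟶ Y) : ∃ p, f = homMk p :=
  (Quotient.exists_rep f).imp fun _ h => h.symm

/-- The functor from internal preorders to partial maps. -/
noncomputable def I (C : Type u) [Category.{v} C] [IsPretopos C] :
    InternalPreorder C ⥤ PaPreOrd C where
  obj X := ⟨X⟩
  map f := homMk (PartialMap.ofHom f)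
  map_id _ := rfl
  map_comp f g := (Quotient.sound (PartialMap.ofHom_comp f g)).symm

end PaPreOrd

section Stab

variable {C : Type u} [Category.{v} C] [IsPretopos C]

/-- There is a congruence diagram between `p` and `q`. -/
def CongruenceDiagram {X Y : InternalPreorder C} (p q : PartialMap X Y) : Prop :=
  ∃ (A₀ A₁ A₂ : InternalPreorder C) (α₀ : A₀ ⟶ X) (α₁ : A₀ ⟶ p.dom) (α₂ : A₀ ⟶ q.dom)
    (α₁c : A₁ ⟶ p.dom) (α₂c : A₂ ⟶ q.dom),
    IsComplemented α₀ ∧ α₁ ≫ p.ι = α₀ ∧ α₂ ≫ q.ι = α₀ ∧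
    AreComplements α₁ α₁c ∧ AreComplements α₂ α₂c ∧
    α₁ ≫ p.map = α₂ ≫ q.map ∧
    IsTrivialHom isTrivial (α₁c ≫ p.map) ∧ IsTrivialHom isTrivial (α₂c ≫ q.map)

/-- The congruence on partial maps given by congruence diagrams. -/
def stableRel (C : Type u) [Category.{v} C] [IsPretopos C] : HomRel (PaPreOrd C) :=
  fun X Y f g => ∃ p q : PartialMap X.obj Y.obj,
    f = PaPreOrd.homMk p ∧ g = PaPreOrd.homMk q ∧ CongruenceDiagram p q

/-- The stable category. -/
abbrev Stab (C : Type u) [Category.{v} C] [IsPretopos C] := CategoryTheory.Quotient (stableRel C)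

/-- The canonical functor from internal preorders to the stable category. -/
noncomputable def stabFunctor (C : Type u) [Category.{v} C] [IsPretopos C] :
    InternalPreorder C ⥤ Stab C :=
  PaPreOrd.I C ⋙ CategoryTheory.Quotient.functor (stableRel C)

theorem stab_isZero_empty : IsZero ((stabFunctor C).obj (empty C)) := by
  obtain ⟨h⟩ := empty_isInitial (C := C)
  refine ⟨fun Y => ⟨⟨⟨(stabFunctor C).map (h.to Y.as.obj)⟩, fun f => ?_⟩⟩,
    fun Y => ⟨⟨⟨Quot.mk _ (PaPreOrd.homMk (Y := ⟨empty C⟩)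
      ⟨empty C, h.to _, IsComplemented.initial_to h _, 𝟙 _⟩)⟩, fun f => ?_⟩⟩⟩
  · obtain ⟨f, rfl⟩ := Quot.exists_rep f
    obtain ⟨p, rfl⟩ := PaPreOrd.homMk_surjective f
    refine congrArg (Quot.mk _) (Quotient.sound ?_)
    let e : p.dom ≅ empty C := @asIso _ _ _ _ p.ι (h.isIso_to p.ι)
    exact ⟨e, Category.comp_id _, (h.ofIso e.symm).hom_ext _ _⟩
  · obtain ⟨f, rfl⟩ := Quot.exists_rep f
    obtain ⟨p, rfl⟩ := PaPreOrd.homMk_surjective f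
    refine congrArg (Quot.mk _) (Quotient.sound ?_)
    let e : p.dom ≅ empty C := @asIso _ _ _ _ p.map (h.isIso_to p.map)
    exact ⟨e, (h.ofIso e.symm).hom_ext _ _, Category.comp_id _⟩

instance : HasZeroObject (Stab C) := ⟨_, stab_isZero_empty⟩

noncomputable instance : HasZeroMorphisms (Stab C) := HasZeroObject.zeroMorphismsOfZeroObject

/-- The equivalence relations, as objects of the stable category. -/
def stabEquivalence : ObjectProperty (Stab C) := fun X => isEquivalence X.as.obj

/-- The partial orders, as objects of the stable category. -/
def stabPartialOrder : ObjectProperty (Stab C) := fun X => isPartialOrder X.as.obj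

end Stab

/-!
Everything rests on two facts about the category of internal preorders of a pretopos.

A morphism is trivial exactly when it identifies comparable generalized elements
(`isTrivialHom_iff_le`). Hence the torsion part of a preorder `X` is `core X`, the symmetric part of
its preorder. It is an effective equivalence relation, and the torsion-free quotient
`q : X ⟶ Y` is its quotient in the pretopos, ordered by the image of the preorder of `X`
(`exists_isPosetReflection`). Since `q` is a regular epimorphism both on carriers and on relations,
morphisms that identify `x` and `y` whenever `x ≤ y ≤ x` descend along it
(`IsPosetReflection.exists_desc`), which gives the short exact sequence `core X ⟶ X ⟶ Y`
relative to the trivial objects.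

Complementary subobjects of a preorder are binary coproduct decompositions
(`areComplements_iff_isSum`), which are stable under pullback, disjoint, and have full coprojections.
Consequently the relation defining the stable category is already a congruence
(the instance `Congruence (stableRel C)`), so that equality of stable morphisms is witnessed by a
single common complemented subobject (`stabMk_eq_iff`), and a partial map is zero if and only if it
is trivial (`stabMk_eq_zero_iff`). Preservation of monomorphisms and of coproducts and the closure
of the two classes under isomorphism follow by computing with such witnesses.

The essential point is that the reflection `q` is an epimorphism, and a cokernel of the inclusion of
`core X`, in the stable category. Both hold because every coproduct decomposition of `X` is the
pullback along `q` of one of `Y` (`IsPosetReflection.exists_isSum`): it is classified by a morphism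
`X ⟶ 1 ⨿ 1` to a discrete preorder, and such a morphism factors through `q`. Thus the domain of a
partial map on `X`, and the subobjects that witness a stable equality, descend to `Y`.
-/

/-! ### Coproduct decompositions -/

namespace IsSum

section General

variable {D : Type u} [Category.{v} D] {A B X : D} {α : A ⟶ X} {β : B ⟶ X}

theorem symm (h : IsSum α β) : IsSum β α :=
  of_desc (fun f g => (h.exists_desc g f).imp fun _ => And.symm) fun _ _ h₁ h₂ => h.hom_ext h₂ h₁

theorem iso_comp (h : IsSum α β) {A' B' : D} (e : A' ≅ A) (e' : B' ≅ B) :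
    IsSum (e.hom ≫ α) (e'.hom ≫ β) := by
  refine of_desc (fun f g => ?_) fun f g h₁ h₂ => h.hom_ext ?_ ?_
  · obtain ⟨d, h₁, h₂⟩ := h.exists_desc (e.inv ≫ f) (e'.inv ≫ g)
    exact ⟨d, by simp [h₁], by simp [h₂]⟩
  · simpa using h₁
  · simpa using h₂

theorem isIso_inl (h : IsSum α β) (hB : Nonempty (IsInitial B)) : IsIso α := by
  obtain ⟨h⟩ := h
  obtain ⟨hB⟩ := hB
  exact (BinaryCofan.isColimit_iff_isIso_inl hB _).1 ⟨h⟩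

/-- A coproduct of two coproduct decompositions: if `X = A ⨿ B`, `A = A₁ ⨿ A₂` and
`B = B₁ ⨿ B₂`, then `X = (A₁ ⨿ B₁) ⨿ (A₂ ⨿ B₂)`. -/
theorem interchange (h : IsSum α β) {A₁ A₂ B₁ B₂ S₁ S₂ : D}
    {a₁ : A₁ ⟶ A} {a₂ : A₂ ⟶ A} (ha : IsSum a₁ a₂) {b₁ : B₁ ⟶ B} {b₂ : B₂ ⟶ B} (hb : IsSum b₁ b₂)
    {i₁ : A₁ ⟶ S₁} {j₁ : B₁ ⟶ S₁} (h₁ : IsSum i₁ j₁) {i₂ : A₂ ⟶ S₂} {j₂ : B₂ ⟶ S₂}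
    (h₂ : IsSum i₂ j₂) {s₁ : S₁ ⟶ X} {s₂ : S₂ ⟶ X} (hi₁ : i₁ ≫ s₁ = a₁ ≫ α)
    (hj₁ : j₁ ≫ s₁ = b₁ ≫ β) (hi₂ : i₂ ≫ s₂ = a₂ ≫ α) (hj₂ : j₂ ≫ s₂ = b₂ ≫ β) :
    IsSum s₁ s₂ := by
  refine of_desc (fun f g => ?_) fun f g e₁ e₂ => ?_
  · obtain ⟨dA, hA₁, hA₂⟩ := ha.exists_desc (i₁ ≫ f) (i₂ ≫ g)
    obtain ⟨dB, hB₁, hB₂⟩ := hb.exists_desc (j₁ ≫ f) (j₂ ≫ g)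
    obtain ⟨d, hA, hB⟩ := h.exists_desc dA dB
    refine ⟨d, h₁.hom_ext ?_ ?_, h₂.hom_ext ?_ ?_⟩
    · rw [reassoc_of% hi₁, hA, hA₁]
    · rw [reassoc_of% hj₁, hB, hB₁]
    · rw [reassoc_of% hi₂, hA, hA₂]
    · rw [reassoc_of% hj₂, hB, hB₂]
  · refine h.hom_ext (ha.hom_ext ?_ ?_) (hb.hom_ext ?_ ?_)
    · rw [← reassoc_of% hi₁, ← reassoc_of% hi₁, e₁]
    · rw [← reassoc_of% hi₂, ← reassoc_of% hi₂, e₂]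
    · rw [← reassoc_of% hj₁, ← reassoc_of% hj₁, e₁]
    · rw [← reassoc_of% hj₂, ← reassoc_of% hj₂, e₂]

end General

section Pretopos

variable {C : Type u} [Category.{v} C] [IsPretopos C] {A B X : C} {α : A ⟶ X} {β : B ⟶ X}

/-- A morphism whose pullback along one coprojection is initial factors through the other one. -/
theorem exists_lift_of_disjoint (h : IsSum α β) {T : C} (x : T ⟶ X)
    (hx : ∀ ⦃S : C⦄ (s : S ⟶ T) (b : S ⟶ B), s ≫ x = b ≫ β → Nonempty (IsInitial S)) :
    ∃ l : T ⟶ A, l ≫ α = x := by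
  have := (h.pullback x).isIso_inl (hx _ _ Limits.pullback.condition)
  exact ⟨inv (pullback.fst x α) ≫ pullback.snd x α, by
    rw [Category.assoc, ← Limits.pullback.condition, IsIso.inv_hom_id_assoc]⟩

end Pretopos

end IsSum

namespace InternalPreorder

variable {C : Type u} [Category.{v} C] [IsPretopos C] {A B W X Y Z : InternalPreorder C}

/-! ### Monotonicity and triviality in terms of generalized elements -/

theorem Hom.monotone (f : X ⟶ Y) {T : C} {x y : T ⟶ X.carrier} (h : X.le x y) :
    Y.le (x ≫ f.base) (y ≫ f.base) := by
  obtain ⟨k, rfl, rfl⟩ := h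
  exact ⟨k ≫ f.rel, by rw [Category.assoc, Category.assoc, f.w₁],
    by rw [Category.assoc, Category.assoc, f.w₂]⟩

theorem isEquivalence_iff :
    isEquivalence X ↔ ∀ ⦃T : C⦄ (x y : T ⟶ X.carrier), X.le x y → X.le y x := by
  constructor
  · rintro ⟨s, h₁, h₂⟩ T x y ⟨k, rfl, rfl⟩
    exact ⟨k ≫ s, by rw [Category.assoc, h₁], by rw [Category.assoc, h₂]⟩
  · intro h
    exact h _ _ ⟨𝟙 _, Category.id_comp _, Category.id_comp _⟩

theorem isEquivalence_discrete (T : C) : isEquivalence (discrete T) :=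
  ⟨𝟙 _, Category.id_comp _, Category.id_comp _⟩

theorem isPartialOrder_discrete (T : C) : isPartialOrder (discrete T) := by
  rintro S _ _ ⟨k, rfl, rfl⟩ -
  rfl

/-- A morphism is trivial if and only if it identifies comparable elements: it then factors through
the discrete preorder on its codomain. -/
theorem isTrivialHom_iff {f : X ⟶ Y} :
    IsTrivialHom isTrivial f ↔ X.r₁ ≫ f.base = X.r₂ ≫ f.base := by
  constructor
  · rintro ⟨W, ⟨he, hp⟩, a, b, rfl⟩
    have h := a.monotone (x := X.r₁) (y := X.r₂) ⟨𝟙 _, Category.id_comp _, Category.id_comp _⟩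
    have h' : X.r₁ ≫ a.base = X.r₂ ≫ a.base := hp _ _ h (isEquivalence_iff.1 he _ _ h)
    rw [comp_base, reassoc_of% h']
  · intro h
    obtain ⟨b, hb⟩ := Y.exists_ofElement (𝟙 Y.carrier)
    refine ⟨discrete Y.carrier, ⟨isEquivalence_discrete _, isPartialOrder_discrete _⟩,
      ⟨f.base, X.r₁ ≫ f.base, (Category.comp_id _).symm, h.symm.trans (Category.comp_id _).symm⟩,
      b, hom_ext ?_⟩
    rw [comp_base, hb]
    exact Category.comp_id _

theorem isTrivialHom_iff_le {f : X ⟶ Y} : IsTrivialHom isTrivial f ↔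
    ∀ ⦃T : C⦄ (x y : T ⟶ X.carrier), X.le x y → x ≫ f.base = y ≫ f.base := by
  rw [isTrivialHom_iff]
  constructor
  · rintro h T _ _ ⟨k, rfl, rfl⟩
    rw [Category.assoc, h, Category.assoc]
  · exact fun h => h _ _ ⟨𝟙 _, Category.id_comp _, Category.id_comp _⟩

theorem isTrivialHom_comp {f : X ⟶ Y} (h : IsTrivialHom isTrivial f) (g : Y ⟶ Z) :
    IsTrivialHom isTrivial (f ≫ g) := by
  obtain ⟨W, hW, a, b, rfl⟩ := h
  exact ⟨W, hW, a, b ≫ g, by simp⟩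

theorem isTrivialHom_precomp {f : X ⟶ Y} (h : IsTrivialHom isTrivial f) (g : W ⟶ X) :
    IsTrivialHom isTrivial (g ≫ f) := by
  obtain ⟨W, hW, a, b, rfl⟩ := h
  exact ⟨W, hW, g ≫ a, b, by simp⟩

theorem isTrivialHom_of_comp_mono {f : X ⟶ Y} (g : Y ⟶ Z) [Mono g]
    (h : IsTrivialHom isTrivial (f ≫ g)) : IsTrivialHom isTrivial f := by
  have := mono_base g
  rw [isTrivialHom_iff] at h ⊢
  simpa [← Category.assoc, cancel_mono] using h

/-- A monotone map from an equivalence relation to a partial order is trivial. -/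
theorem isTrivialHom_of_isEquivalence_of_isPartialOrder (f : X ⟶ Y) (hX : isEquivalence X)
    (hY : isPartialOrder Y) : IsTrivialHom isTrivial f :=
  isTrivialHom_iff_le.2 fun _ x y h =>
    hY _ _ (f.monotone h) (f.monotone (isEquivalence_iff.1 hX x y h))

theorem isPartialOrder_of_mono (f : X ⟶ Y) [Mono f] (hY : isPartialOrder Y) :
    isPartialOrder X := by
  have := mono_base f
  intro T x y h h'
  rw [← cancel_mono f.base]
  exact hY _ _ (f.monotone h) (f.monotone h')

/-! ### Extensivity of the category of internal preorders -/

theorem isSum_base_rel {α : A ⟶ X} {β : B ⟶ X} (h : IsSum α β) :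
    IsSum α.base β.base ∧ IsSum α.rel β.rel := by
  have hs := isSum_inl_inr (X := A) (Y := B)
  obtain ⟨d, h₁, h₂⟩ := hs.exists_desc α β
  obtain ⟨e, k₁, k₂⟩ := h.exists_desc (inl A B) (inr A B)
  have : IsIso d := ⟨e, hs.hom_ext (by rw [reassoc_of% h₁, k₁, Category.comp_id])
    (by rw [reassoc_of% h₂, k₂, Category.comp_id]), h.hom_ext
    (by rw [reassoc_of% k₁, h₁, Category.comp_id]) (by rw [reassoc_of% k₂, h₂, Category.comp_id])⟩
  subst h₁ h₂
  exact ⟨(IsSum.coprod _ _).comp_iso d.base (isIso_base d),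
    (IsSum.coprod _ _).comp_iso d.rel (isIso_rel d)⟩

/-- Complementary subobjects of an internal preorder are the same thing as binary coproduct
decompositions. -/
theorem areComplements_iff_isSum {α : A ⟶ X} {β : B ⟶ X} : AreComplements α β ↔ IsSum α β :=
  ⟨fun h => isSum_of_base_rel h.isSum_base_rel.1 h.isSum_base_rel.2,
    fun h => areComplements_of_isSum (isSum_base_rel h).1 (isSum_base_rel h).2⟩

theorem isComplemented_iff_exists_isSum {α : A ⟶ X} :
    IsComplemented α ↔ ∃ (B : InternalPreorder C) (β : B ⟶ X), IsSum α β := by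
  simp only [IsComplemented, areComplements_iff_isSum]

theorem isSum_pullback {α : A ⟶ X} {β : B ⟶ X} (h : IsSum α β) (f : Y ⟶ X) :
    IsSum (pbFst f α) (pbFst f β) :=
  areComplements_iff_isSum.1 ((areComplements_iff_isSum.2 h).pullback f)

theorem isSum_mono_inl {α : A ⟶ X} {β : B ⟶ X} (h : IsSum α β) : Mono α :=
  mono_of_base α (isSum_base_rel h).1.mono_inl

theorem isSum_disjoint {α : A ⟶ X} {β : B ⟶ X} (h : IsSum α β) {T : InternalPreorder C}
    (x : T ⟶ A) (y : T ⟶ B) (e : x ≫ α = y ≫ β) : Nonempty (IsInitial T) :=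
  (areComplements_iff_isSum.2 h).disjoint x y e

theorem isSum_exists_lift {α : A ⟶ X} {β : B ⟶ X} (h : IsSum α β) (x : W ⟶ X)
    (hx : ∀ ⦃S : InternalPreorder C⦄ (s : S ⟶ W) (b : S ⟶ B), s ≫ x = b ≫ β →
      Nonempty (IsInitial S)) :
    ∃ l : W ⟶ A, l ≫ α = x := by
  have := (isSum_pullback h x).isIso_inl (hx _ _ (pb_condition x β))
  exact ⟨inv (pbFst x α) ≫ pbSnd x α, by
    rw [Category.assoc, ← pb_condition, IsIso.inv_hom_id_assoc]⟩

/-- A morphism compatible with two coproduct decompositions exhibits the summands of its domain as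
the pullbacks of those of its codomain. -/
theorem isPullback_of_isSum {α : A ⟶ X} {β : B ⟶ X} (h : IsSum α β) {A' B' : InternalPreorder C}
    {α' : A' ⟶ Y} {β' : B' ⟶ Y} (h' : IsSum α' β') {f : X ⟶ Y} {a : A ⟶ A'} {b : B ⟶ B'}
    (ha : α ≫ f = a ≫ α') (hb : β ≫ f = b ≫ β') : IsPullback α a f α' := by
  have mα := isSum_mono_inl h
  have mα' := isSum_mono_inl h'
  have lift (s : PullbackCone f α') : ∃ l : s.pt ⟶ A, l ≫ α = s.fst := by
    refine isSum_exists_lift h s.fst fun S t c e => ?_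
    refine isSum_disjoint h' (t ≫ s.snd) (c ≫ b) ?_
    rw [Category.assoc, ← s.condition, reassoc_of% e, hb, Category.assoc]
  choose l hl using lift
  refine ⟨⟨ha⟩, ⟨PullbackCone.IsLimit.mk _ l hl (fun s => ?_) (fun s m hm _ => ?_)⟩⟩
  · rw [← cancel_mono α', Category.assoc, ← ha, reassoc_of% (hl s), s.condition]
  · rw [← cancel_mono α, hm, hl]

/-- The coprojections of a coproduct of internal preorders are full. -/
theorem le_of_isSum_inl {α : A ⟶ X} {β : B ⟶ X} (h : IsSum α β) {T : C} {x y : T ⟶ A.carrier}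
    (hxy : X.le (x ≫ α.base) (y ≫ α.base)) : A.le x y := by
  obtain ⟨hb, hr⟩ := isSum_base_rel h
  have := hb.mono_inl
  obtain ⟨k, h₁, h₂⟩ := hxy
  obtain ⟨l, rfl⟩ := hr.exists_lift_of_disjoint k fun S s b e =>
    hb.disjoint (s ≫ x) (b ≫ B.r₁) (by
      rw [Category.assoc, ← h₁, reassoc_of% e, Category.assoc, β.w₁])
  refine ⟨l, ?_, ?_⟩
  · rw [← cancel_mono α.base, ← h₁, Category.assoc, Category.assoc, α.w₁]
  · rw [← cancel_mono α.base, ← h₂, Category.assoc, Category.assoc, α.w₂]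

theorem isEquivalence_of_isSum_inl {α : A ⟶ X} {β : B ⟶ X} (h : IsSum α β)
    (hX : isEquivalence X) : isEquivalence A :=
  isEquivalence_iff.2 fun _ _ _ hxy =>
    le_of_isSum_inl h (isEquivalence_iff.1 hX _ _ (α.monotone hxy))

/-! ### Morphisms that are trivial off a complemented subobject -/

/-- The morphism `f` is trivial on a complement of the subobject `α` of its domain. -/
def IsTrivialOff (α : A ⟶ X) (f : X ⟶ Y) : Prop :=
  ∃ (E : InternalPreorder C) (ε : E ⟶ X), IsSum α ε ∧ IsTrivialHom isTrivial (ε ≫ f)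

theorem IsTrivialOff.isComplemented {α : A ⟶ X} {f : X ⟶ Y} (h : IsTrivialOff α f) :
    IsComplemented α := by
  obtain ⟨E, ε, h, -⟩ := h
  exact isComplemented_iff_exists_isSum.2 ⟨E, ε, h⟩

theorem IsTrivialOff.of_isIso (α : A ⟶ X) [IsIso α] (f : X ⟶ Y) : IsTrivialOff α f := by
  obtain ⟨hI⟩ := empty_isInitial (C := C)
  refine ⟨empty C, hI.to X, IsSum.of_isIso hI _, isTrivialHom_iff.2 ?_⟩
  exact initialIsInitial.hom_ext _ _

theorem IsTrivialOff.of_isInitial {α : A ⟶ X} {f : X ⟶ Y} (hA : IsInitial A)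
    (h : IsTrivialHom isTrivial f) : IsTrivialOff α f :=
  ⟨X, 𝟙 X, (IsSum.of_isIso (i₁ := 𝟙 X) hA α).symm, by rwa [Category.id_comp]⟩

theorem IsTrivialOff.comp {α : A ⟶ X} {f : X ⟶ Y} (h : IsTrivialOff α f) (g : Y ⟶ Z) :
    IsTrivialOff α (f ≫ g) := by
  obtain ⟨E, ε, h, ht⟩ := h
  exact ⟨E, ε, h, by simpa using isTrivialHom_comp ht g⟩

theorem IsTrivialOff.of_comp_mono {α : A ⟶ X} {f : X ⟶ Y} (g : Y ⟶ Z) [Mono g]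
    (h : IsTrivialOff α (f ≫ g)) : IsTrivialOff α f := by
  obtain ⟨E, ε, h, ht⟩ := h
  exact ⟨E, ε, h, isTrivialHom_of_comp_mono g (by simpa using ht)⟩

theorem IsTrivialOff.of_isPullback {α : A ⟶ X} {f : X ⟶ Y} (h : IsTrivialOff α f)
    {a : B ⟶ W} {b : B ⟶ A} {g : W ⟶ X} (hp : IsPullback a b g α) : IsTrivialOff a (g ≫ f) := by
  obtain ⟨E, ε, h, ht⟩ := h
  refine ⟨pb g ε, pbFst g ε, ?_, ?_⟩
  · have := (isSum_pullback h g).iso_comp (hp.isoIsPullback _ _ (pb_isPullback g α)) (Iso.refl _)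
    simpa using this
  · have := isTrivialHom_precomp ht (pbSnd g ε)
    rwa [← Category.assoc, ← pb_condition, Category.assoc] at this

theorem isTrivialHom_of_isSum {α : A ⟶ X} {β : B ⟶ X} (h : IsSum α β) {f : X ⟶ Y}
    (hα : IsTrivialHom isTrivial (α ≫ f)) (hβ : IsTrivialHom isTrivial (β ≫ f)) :
    IsTrivialHom isTrivial f := by
  rw [isTrivialHom_iff] at hα hβ ⊢
  refine (isSum_base_rel h).2.hom_ext ?_ ?_
  · simpa [← reassoc_of% α.w₁, ← reassoc_of% α.w₂] using hα
  · simpa [← reassoc_of% β.w₁, ← reassoc_of% β.w₂] using hβ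

theorem IsTrivialOff.trans {β : B ⟶ A} {α : A ⟶ X} {f : X ⟶ Y} (hα : IsTrivialOff α f)
    (hβ : IsTrivialOff β (α ≫ f)) : IsTrivialOff (β ≫ α) f := by
  obtain ⟨E, ε, h, ht⟩ := hα
  obtain ⟨E', ε', h', ht'⟩ := hβ
  obtain ⟨d, h₁, h₂⟩ := (isSum_inl_inr (X := E') (Y := E)).exists_desc (ε' ≫ α) ε
  refine ⟨sum E' E, d, h.assoc h' isSum_inl_inr d h₁ h₂,
    isTrivialHom_of_isSum isSum_inl_inr ?_ ?_⟩
  · rwa [reassoc_of% h₁]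
  · rwa [reassoc_of% h₂]

end InternalPreorder

/-! ### The stable congruence -/

section StableCongruence

variable {C : Type u} [Category.{v} C] [IsPretopos C] {W X Y Z : InternalPreorder C}

namespace PartialMap

/-- Two partial maps are stably equal if they agree on a common complemented subobject of their
domains and are trivial off it. -/
def StablyEq (p q : PartialMap X Y) : Prop :=
  ∃ (A : InternalPreorder C) (α : A ⟶ p.dom) (β : A ⟶ q.dom), α ≫ p.ι = β ≫ q.ι ∧
    α ≫ p.map = β ≫ q.map ∧ IsTrivialOff α p.map ∧ IsTrivialOff β q.map

theorem congruenceDiagram_iff {p q : PartialMap X Y} : CongruenceDiagram p q ↔ p.StablyEq q := by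
  constructor
  · rintro ⟨A, E, F, α₀, α, β, ε, φ, -, hp, hq, hα, hβ, h, hε, hφ⟩
    exact ⟨A, α, β, hp.trans hq.symm, h, ⟨E, ε, areComplements_iff_isSum.1 hα, hε⟩,
      ⟨F, φ, areComplements_iff_isSum.1 hβ, hφ⟩⟩
  · rintro ⟨A, α, β, hι, h, hα, hβ⟩
    have hc := hα.isComplemented.comp p.complemented
    obtain ⟨E, ε, hα, hε⟩ := hα
    obtain ⟨F, φ, hβ, hφ⟩ := hβ
    exact ⟨A, E, F, α ≫ p.ι, α, β, ε, φ, hc, rfl, hι.symm, areComplements_iff_isSum.2 hα,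
      areComplements_iff_isSum.2 hβ, h, hε, hφ⟩

theorem StablyEq.of_rel {p q : PartialMap X Y} (h : (setoid X Y).r p q) : p.StablyEq q := by
  obtain ⟨e, h₁, h₂⟩ := h
  exact ⟨p.dom, 𝟙 _, e.hom, by simp [h₁], by simp [h₂], .of_isIso _ _, .of_isIso _ _⟩

theorem StablyEq.refl (p : PartialMap X Y) : p.StablyEq p := .of_rel ((setoid X Y).refl p)

theorem StablyEq.symm {p q : PartialMap X Y} (h : p.StablyEq q) : q.StablyEq p := by
  obtain ⟨A, α, β, h₁, h₂, hα, hβ⟩ := h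
  exact ⟨A, β, α, h₁.symm, h₂.symm, hβ, hα⟩

theorem StablyEq.trans {p q r : PartialMap X Y} (h : p.StablyEq q) (h' : q.StablyEq r) :
    p.StablyEq r := by
  obtain ⟨A, α, β, h₁, h₂, hα, hβ⟩ := h
  obtain ⟨B, γ, δ, k₁, k₂, hγ, hδ⟩ := h'
  have hp := pb_isPullback β γ
  refine ⟨pb β γ, pbFst β γ ≫ α, pbSnd β γ ≫ δ, ?_, ?_, hα.trans ?_, hδ.trans ?_⟩
  · rw [Category.assoc, Category.assoc, h₁, ← k₁, hp.w_assoc]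
  · rw [Category.assoc, Category.assoc, h₂, ← k₂, hp.w_assoc]
  · rw [h₂]
    exact hγ.of_isPullback hp
  · rw [← k₂]
    exact hβ.of_isPullback hp.flip

theorem StablyEq.comp_left (p : PartialMap X Y) {q q' : PartialMap Y Z} (h : q.StablyEq q') :
    (p.comp q).StablyEq (p.comp q') := by
  obtain ⟨A, α, β, h₁, h₂, hα, hβ⟩ := h
  have hA := pb_isPullback p.map (α ≫ q.ι)
  have hq := pb_isPullback p.map q.ι
  have hq' := pb_isPullback p.map q'.ι
  have w : pbFst p.map (α ≫ q.ι) ≫ p.map = (pbSnd p.map (α ≫ q.ι) ≫ α) ≫ q.ι := by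
    rw [hA.w, Category.assoc]
  have w' : pbFst p.map (α ≫ q.ι) ≫ p.map = (pbSnd p.map (α ≫ q.ι) ≫ β) ≫ q'.ι := by
    rw [hA.w, h₁, Category.assoc]
  have s : IsPullback (hq.lift _ _ w) (pbSnd p.map (α ≫ q.ι)) (pbSnd p.map q.ι) α :=
    IsPullback.of_right (by simpa using hA) (by simp) hq
  have s' : IsPullback (hq'.lift _ _ w') (pbSnd p.map (α ≫ q.ι)) (pbSnd p.map q'.ι) β :=
    IsPullback.of_right (by simpa [← h₁] using hA) (by simp) hq'
  refine ⟨pb p.map (α ≫ q.ι), hq.lift _ _ w, hq'.lift _ _ w', ?_, ?_, hα.of_isPullback s,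
    hβ.of_isPullback s'⟩
  · simp [comp]
  · simp [comp, h₂]

theorem StablyEq.comp_right {p p' : PartialMap X Y} (q : PartialMap Y Z) (h : p.StablyEq p') :
    (p.comp q).StablyEq (p'.comp q) := by
  obtain ⟨A, α, β, h₁, h₂, hα, hβ⟩ := h
  have := q.complemented.mono
  have hA := pb_isPullback (α ≫ p.map) q.ι
  have hp := pb_isPullback p.map q.ι
  have hp' := pb_isPullback p'.map q.ι
  have w : (pbFst (α ≫ p.map) q.ι ≫ α) ≫ p.map = pbSnd (α ≫ p.map) q.ι ≫ q.ι := by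
    rw [← hA.w, Category.assoc]
  have w' : (pbFst (α ≫ p.map) q.ι ≫ β) ≫ p'.map = pbSnd (α ≫ p.map) q.ι ≫ q.ι := by
    rw [← hA.w, h₂, Category.assoc]
  -- A morphism into the domain of `q` is trivial as soon as its composite with the inclusion is.
  have key {r : PartialMap X Y} {B : InternalPreorder C} {γ : B ⟶ r.dom} {D : InternalPreorder C}
      {δ : D ⟶ pb r.map q.ι} {d : D ⟶ B} (h : IsTrivialOff γ r.map)
      (hp : IsPullback δ d (pbFst r.map q.ι) γ) : IsTrivialOff δ (r.comp q).map := by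
    refine IsTrivialOff.comp (IsTrivialOff.of_comp_mono q.ι ?_) q.map
    rw [← pb_condition]
    exact h.of_isPullback hp
  have s : IsPullback (hp.lift _ _ w) (pbFst (α ≫ p.map) q.ι) (pbFst p.map q.ι) α :=
    IsPullback.of_right (by simpa using hA.flip) (by simp) hp.flip
  have s' : IsPullback (hp'.lift _ _ w') (pbFst (α ≫ p.map) q.ι) (pbFst p'.map q.ι) β :=
    IsPullback.of_right (by simpa [← h₂] using hA.flip) (by simp) hp'.flip
  refine ⟨pb (α ≫ p.map) q.ι, hp.lift _ _ w, hp'.lift _ _ w', ?_, ?_, key hα s, key hβ s'⟩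
  · simp [comp, h₁]
  · simp [comp]

end PartialMap

theorem stableRel_homMk_iff {X Y : PaPreOrd C} {p q : PartialMap X.obj Y.obj} :
    stableRel C (PaPreOrd.homMk p) (PaPreOrd.homMk q) ↔ p.StablyEq q := by
  constructor
  · rintro ⟨p', q', hp, hq, h⟩
    exact (PartialMap.StablyEq.of_rel (Quotient.exact hp)).trans
      ((PartialMap.congruenceDiagram_iff.1 h).trans
        (PartialMap.StablyEq.of_rel (Quotient.exact hq)).symm)
  · exact fun h => ⟨p, q, rfl, rfl, PartialMap.congruenceDiagram_iff.2 h⟩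

instance : Congruence (stableRel C) where
  comp_left {X Y Z} f g g' h := by
    obtain ⟨p, rfl⟩ := PaPreOrd.homMk_surjective f
    obtain ⟨q, q', rfl, rfl, h⟩ := h
    exact stableRel_homMk_iff.2 ((PartialMap.congruenceDiagram_iff.1 h).comp_left p)
  comp_right {X Y Z} f f' g h := by
    obtain ⟨q, rfl⟩ := PaPreOrd.homMk_surjective g
    obtain ⟨p, p', rfl, rfl, h⟩ := h
    exact stableRel_homMk_iff.2 ((PartialMap.congruenceDiagram_iff.1 h).comp_right q)
  equivalence {X Y} := by
    refine ⟨fun f => ?_, ?_, ?_⟩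
    · obtain ⟨p, rfl⟩ := PaPreOrd.homMk_surjective f
      exact stableRel_homMk_iff.2 (.refl p)
    · rintro f g ⟨p, q, rfl, rfl, h⟩
      exact stableRel_homMk_iff.2 (PartialMap.congruenceDiagram_iff.1 h).symm
    · rintro f g k ⟨p, q, rfl, rfl, h⟩ h'
      obtain ⟨r, rfl⟩ := PaPreOrd.homMk_surjective k
      exact stableRel_homMk_iff.2
        ((PartialMap.congruenceDiagram_iff.1 h).trans (stableRel_homMk_iff.1 h'))

/-! ### Morphisms of the stable category -/

/-- The morphism of the stable category represented by a partial map. -/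
noncomputable def stabMk (p : PartialMap X Y) : (stabFunctor C).obj X ⟶ (stabFunctor C).obj Y :=
  (CategoryTheory.Quotient.functor (stableRel C)).map
    (PaPreOrd.homMk (X := ⟨X⟩) (Y := ⟨Y⟩) p)

theorem stabFunctor_obj_surjective (X : Stab C) :
    ∃ Y : InternalPreorder C, X = (stabFunctor C).obj Y :=
  ⟨X.as.obj, rfl⟩

theorem stabMk_surjective (f : (stabFunctor C).obj X ⟶ (stabFunctor C).obj Y) :
    ∃ p, stabMk p = f := by
  obtain ⟨f, rfl⟩ := (CategoryTheory.Quotient.functor (stableRel C)).map_surjective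
    (X := (⟨X⟩ : PaPreOrd C)) (Y := ⟨Y⟩) f
  obtain ⟨p, rfl⟩ := PaPreOrd.homMk_surjective f
  exact ⟨p, rfl⟩

theorem stabMk_eq_iff {p q : PartialMap X Y} : stabMk p = stabMk q ↔ p.StablyEq q :=
  (CategoryTheory.Quotient.functor_map_eq_iff _ _ _).trans stableRel_homMk_iff

theorem stabMk_comp (p : PartialMap X Y) (q : PartialMap Y Z) :
    stabMk p ≫ stabMk q = stabMk (p.comp q) :=
  ((CategoryTheory.Quotient.functor (stableRel C)).map_comp _ _).symm

theorem stabFunctor_map (f : X ⟶ Y) : (stabFunctor C).map f = stabMk (.ofHom f) := rfl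

theorem stabMk_id (X : InternalPreorder C) :
    stabMk (.ofHom (𝟙 X)) = 𝟙 ((stabFunctor C).obj X) :=
  (stabFunctor C).map_id X

theorem stabMk_comp_map (p : PartialMap X Y) (f : Y ⟶ Z) :
    stabMk p ≫ (stabFunctor C).map f = stabMk ⟨p.dom, p.ι, p.complemented, p.map ≫ f⟩ := by
  rw [stabFunctor_map, stabMk_comp]
  exact stabMk_eq_iff.2 (.of_rel (PartialMap.comp_rel_of_isPullback _ _ _ (𝟙 _) p.map
    (IsPullback.of_horiz_isIso ⟨by simp [PartialMap.ofHom]⟩) (by simp) rfl))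

theorem map_comp_stabMk (f : X ⟶ Y) (p : PartialMap Y Z) (q : PartialMap X Z)
    (g : q.dom ⟶ p.dom) (h : IsPullback q.ι g f p.ι) (hq : g ≫ p.map = q.map) :
    (stabFunctor C).map f ≫ stabMk p = stabMk q := by
  rw [stabFunctor_map, stabMk_comp]
  exact stabMk_eq_iff.2 (.of_rel (PartialMap.comp_rel_of_isPullback _ _ _ q.ι g h
    (Category.comp_id _) hq))

theorem stabMk_eq_zero_iff {p : PartialMap X Y} :
    stabMk p = 0 ↔ IsTrivialHom isTrivial p.map := by
  obtain ⟨hI⟩ := empty_isInitial (C := C)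
  have h0 : stabMk (⟨empty C, hI.to X, .initial_to hI _, hI.to Y⟩ : PartialMap X Y) = 0 := by
    have := stabMk_comp_map (⟨empty C, hI.to X, .initial_to hI _, 𝟙 _⟩ : PartialMap X (empty C))
      (hI.to Y)
    simp only [Category.id_comp] at this
    rw [← this]
    exact (congrArg (· ≫ _) (stab_isZero_empty.eq_zero_of_tgt _)).trans zero_comp
  rw [← h0, stabMk_eq_iff]
  constructor
  · rintro ⟨A, α, β, -, -, ⟨E, ε, h, ht⟩, -⟩
    refine isTrivialHom_of_isSum h (isTrivialHom_iff.2 ?_) ht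
    obtain ⟨hr⟩ := carrier_of_isInitial (X := A) (IsInitial.ofStrict β hI)
    exact (IsInitial.ofStrict A.r₁ hr).hom_ext _ _
  · intro h
    exact ⟨empty C, hI.to _, 𝟙 _, hI.hom_ext _ _, hI.hom_ext _ _, .of_isInitial hI h,
      .of_isIso _ _⟩

theorem stabFunctor_map_eq_zero {f : X ⟶ Y} (h : IsTrivialHom isTrivial f) :
    (stabFunctor C).map f = 0 :=
  stabMk_eq_zero_iff.2 h

/-! ### Equivalence relations and partial orders in the stable category -/

theorem stab_zero_hom {X Y : Stab C} (f : X ⟶ Y) (hX : stabEquivalence X)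
    (hY : stabPartialOrder Y) : f = 0 := by
  obtain ⟨p, rfl⟩ := stabMk_surjective (X := X.as.obj) (Y := Y.as.obj) f
  obtain ⟨B, β, h⟩ := isComplemented_iff_exists_isSum.1 p.complemented
  exact stabMk_eq_zero_iff.2 (isTrivialHom_of_isEquivalence_of_isPartialOrder _
    (isEquivalence_of_isSum_inl h hX) hY)

/-- If `q` followed by `p` is the identity of `Y` in the stable category, then `Y` is the coproduct
of a part on which `p` retracts `q` and of a discrete part. -/
theorem exists_isSum_of_comp_eq_id {p : PartialMap X Y} {q : PartialMap Y X}
    (h : stabMk q ≫ stabMk p = 𝟙 _) :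
    ∃ (A E : InternalPreorder C) (α : A ⟶ Y) (ε : E ⟶ Y) (t : A ⟶ p.dom),
      IsSum α ε ∧ IsTrivialHom isTrivial ε ∧ t ≫ p.map = α := by
  rw [stabMk_comp, ← stabMk_id, stabMk_eq_iff] at h
  obtain ⟨A, α, β, -, h, -, E, ε, hs, ht⟩ := h
  exact ⟨A, E, β, ε, α ≫ pbSnd _ _, hs, (congrArg _ (Category.comp_id ε)).mp ht,
    (Category.assoc _ _ _).trans (h.trans
      (Category.comp_id _))⟩

theorem isEquivalence_of_comp_eq_id {p : PartialMap X Y} {q : PartialMap Y X}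
    (h : stabMk q ≫ stabMk p = 𝟙 _) (hX : isEquivalence X) : isEquivalence Y := by
  obtain ⟨A, E, α, ε, t, hs, ht, rfl⟩ := exists_isSum_of_comp_eq_id h
  obtain ⟨B, β, hp⟩ := isComplemented_iff_exists_isSum.1 p.complemented
  have hd := isEquivalence_of_isSum_inl hp hX
  have key : Y.le Y.r₂ Y.r₁ := by
    refine Y.le_of_isSum (isSum_base_rel hs).2 ?_ ?_
    · rw [← Hom.w₁, ← Hom.w₂, comp_base, ← Category.assoc, ← Category.assoc]
      refine p.map.monotone (isEquivalence_iff.1 hd _ _ (t.monotone ?_))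
      exact ⟨𝟙 _, Category.id_comp _, Category.id_comp _⟩
    · rw [← Hom.w₁, ← Hom.w₂, isTrivialHom_iff.1 ht]
      exact Y.le_refl _
  exact key

theorem isPartialOrder_of_comp_eq_id {p : PartialMap X Y} {q : PartialMap Y X}
    (h : stabMk q ≫ stabMk p = 𝟙 _) (hX : isPartialOrder X) : isPartialOrder Y := by
  obtain ⟨A, E, α, ε, t, hs, ht, hα⟩ := exists_isSum_of_comp_eq_id h
  have := p.complemented.mono
  have hd := isPartialOrder_of_mono p.ι hX
  rintro T x y ⟨k, h₁, h₂⟩ hyx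
  -- Split `T` according to the summand of `Y` that contains the pair `x ≤ y`.
  have hT := (isSum_base_rel hs).2.pullback k
  have c₁ := pullback.condition (f := k) (g := α.rel)
  have c₂ := pullback.condition (f := k) (g := ε.rel)
  refine hT.hom_ext ?_ ?_
  · have ex : pullback.fst k α.rel ≫ x = (pullback.snd k α.rel ≫ A.r₁) ≫ α.base := by
      rw [← h₁, reassoc_of% c₁, Category.assoc, α.w₁]
    have ey : pullback.fst k α.rel ≫ y = (pullback.snd k α.rel ≫ A.r₂) ≫ α.base := by
      rw [← h₂, reassoc_of% c₁, Category.assoc, α.w₂]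
    have hyx' := Y.comp_le (pullback.fst k α.rel) hyx
    rw [ex, ey] at hyx' ⊢
    have e := hd _ _ (t.monotone ⟨pullback.snd k α.rel, rfl, rfl⟩)
      (t.monotone (le_of_isSum_inl hs hyx'))
    have hb : α.base = t.base ≫ p.map.base := congrArg Hom.base hα.symm
    rw [hb, ← Category.assoc, e, Category.assoc]
  · rw [← h₁, ← h₂, reassoc_of% c₂, reassoc_of% c₂, ← ε.w₁, ← ε.w₂, isTrivialHom_iff.1 ht]

theorem stabEquivalence_isClosedUnderIsomorphisms :
    (stabEquivalence (C := C)).IsClosedUnderIsomorphisms where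
  of_iso {X Y} e hX := by
    obtain ⟨p, hp⟩ := stabMk_surjective (X := X.as.obj) (Y := Y.as.obj) e.hom
    obtain ⟨q, hq⟩ := stabMk_surjective (X := Y.as.obj) (Y := X.as.obj) e.inv
    refine isEquivalence_of_comp_eq_id (p := p) (q := q) ?_ hX
    rw [hp, hq]
    exact e.inv_hom_id

theorem stabPartialOrder_isClosedUnderIsomorphisms :
    (stabPartialOrder (C := C)).IsClosedUnderIsomorphisms where
  of_iso {X Y} e hX := by
    obtain ⟨p, hp⟩ := stabMk_surjective (X := X.as.obj) (Y := Y.as.obj) e.hom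
    obtain ⟨q, hq⟩ := stabMk_surjective (X := Y.as.obj) (Y := X.as.obj) e.inv
    refine isPartialOrder_of_comp_eq_id (p := p) (q := q) ?_ hX
    rw [hp, hq]
    exact e.inv_hom_id

/-! ### Preservation of monomorphisms and of finite coproducts -/

theorem mono_stabFunctor_map (f : X ⟶ Y) [Mono f] : Mono ((stabFunctor C).map f) := by
  refine ⟨fun {W} g h e => ?_⟩
  obtain ⟨p, rfl⟩ := stabMk_surjective (X := W.as.obj) g
  obtain ⟨q, rfl⟩ := stabMk_surjective (X := W.as.obj) h
  replace e := (stabMk_comp_map p f).symm.trans (e.trans (stabMk_comp_map q f))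
  obtain ⟨A, α, β, h₁, h₂, hα, hβ⟩ := stabMk_eq_iff.1 e
  refine stabMk_eq_iff.2 ⟨A, α, β, h₁, ?_, hα.of_comp_mono f, hβ.of_comp_mono f⟩
  rw [← cancel_mono f]
  simpa using h₂

theorem stabFunctor_preservesMonomorphisms : (stabFunctor C).PreservesMonomorphisms :=
  ⟨fun f _ => mono_stabFunctor_map f⟩

theorem PartialMap.StablyEq.of_isSum {i : X ⟶ Z} {j : Y ⟶ Z} (h : IsSum i j)
    {p q : PartialMap Z W}
    (hX : (stabFunctor C).map i ≫ stabMk p = (stabFunctor C).map i ≫ stabMk q)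
    (hY : (stabFunctor C).map j ≫ stabMk p = (stabFunctor C).map j ≫ stabMk q) :
    p.StablyEq q := by
  have restrict {V : InternalPreorder C} (k : V ⟶ Z) (r : PartialMap Z W) :=
    map_comp_stabMk k r ⟨_, pbFst k r.ι, r.complemented.pullback k, pbSnd k r.ι ≫ r.map⟩ _
      (pb_isPullback k r.ι) rfl
  rw [restrict, restrict, stabMk_eq_iff] at hX hY
  obtain ⟨A, α, β, h₁, h₂, ⟨E, ε, hα, hε⟩, ⟨F, φ, hβ, hφ⟩⟩ := hX
  obtain ⟨A', α', β', h₁', h₂', ⟨E', ε', hα', hε'⟩, ⟨F', φ', hβ', hφ'⟩⟩ := hY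
  -- The domain of a partial map on `Z` is the coproduct of its restrictions to `X` and `Y`.
  have hsum (r : PartialMap Z W) : IsSum (pbSnd i r.ι) (pbSnd j r.ι) := by
    have e {V : InternalPreorder C} (k : V ⟶ Z) :=
      (pb_isPullback k r.ι).flip.isoIsPullback_hom_fst _ _ (pb_isPullback r.ι k)
    rw [← e i, ← e j]
    exact (isSum_pullback h r.ι).iso_comp _ _
  obtain ⟨a, ha₁, ha₂⟩ := (isSum_inl_inr (X := A) (Y := A')).exists_desc
    (α ≫ pbSnd i p.ι) (α' ≫ pbSnd j p.ι)
  obtain ⟨b, hb₁, hb₂⟩ := (isSum_inl_inr (X := A) (Y := A')).exists_desc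
    (β ≫ pbSnd i q.ι) (β' ≫ pbSnd j q.ι)
  obtain ⟨e, he₁, he₂⟩ := (isSum_inl_inr (X := E) (Y := E')).exists_desc
    (ε ≫ pbSnd i p.ι) (ε' ≫ pbSnd j p.ι)
  obtain ⟨f, hf₁, hf₂⟩ := (isSum_inl_inr (X := F) (Y := F')).exists_desc
    (φ ≫ pbSnd i q.ι) (φ' ≫ pbSnd j q.ι)
  refine ⟨sum A A', a, b, isSum_inl_inr.hom_ext ?_ ?_, isSum_inl_inr.hom_ext ?_ ?_,
    ⟨sum E E', e, (hsum p).interchange hα hα' isSum_inl_inr isSum_inl_inr ha₁ ha₂ he₁ he₂,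
      isTrivialHom_of_isSum isSum_inl_inr ?_ ?_⟩,
    ⟨sum F F', f, (hsum q).interchange hβ hβ' isSum_inl_inr isSum_inl_inr hb₁ hb₂ hf₁ hf₂,
      isTrivialHom_of_isSum isSum_inl_inr ?_ ?_⟩⟩
  · simpa [reassoc_of% ha₁, reassoc_of% hb₁, ← pb_condition] using h₁ =≫ i
  · simpa [reassoc_of% ha₂, reassoc_of% hb₂, ← pb_condition] using h₁' =≫ j
  · simpa [reassoc_of% ha₁, reassoc_of% hb₁] using h₂
  · simpa [reassoc_of% ha₂, reassoc_of% hb₂] using h₂'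
  · simpa [reassoc_of% he₁] using hε
  · simpa [reassoc_of% he₂] using hε'
  · simpa [reassoc_of% hf₁] using hφ
  · simpa [reassoc_of% hf₂] using hφ'

theorem isSum_stabFunctor_map {i : X ⟶ Z} {j : Y ⟶ Z} (h : IsSum i j) :
    IsSum ((stabFunctor C).map i) ((stabFunctor C).map j) := by
  refine IsSum.of_desc (fun {W} f g => ?_) (fun {W} f g h₁ h₂ => ?_)
  · obtain ⟨p, rfl⟩ := stabMk_surjective (Y := W.as.obj) f
    obtain ⟨q, rfl⟩ := stabMk_surjective (Y := W.as.obj) g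
    obtain ⟨P, π, hp⟩ := isComplemented_iff_exists_isSum.1 p.complemented
    obtain ⟨Q, κ, hq⟩ := isComplemented_iff_exists_isSum.1 q.complemented
    have hs := isSum_inl_inr (X := p.dom) (Y := q.dom)
    obtain ⟨d, hd₁, hd₂⟩ := hs.exists_desc (p.ι ≫ i) (q.ι ≫ j)
    obtain ⟨e, he₁, he₂⟩ := (isSum_inl_inr (X := P) (Y := Q)).exists_desc (π ≫ i) (κ ≫ j)
    obtain ⟨m, hm₁, hm₂⟩ := hs.exists_desc p.map q.map
    refine ⟨stabMk ⟨sum p.dom q.dom, d, isComplemented_iff_exists_isSum.2 ⟨_, e,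
      h.interchange hp hq hs isSum_inl_inr hd₁ hd₂ he₁ he₂⟩, m⟩, ?_, ?_⟩
    · exact map_comp_stabMk i _ p (inl _ _) (isPullback_of_isSum hs h hd₁ hd₂).flip hm₁
    · exact map_comp_stabMk j _ q (inr _ _)
        (isPullback_of_isSum hs.symm h.symm hd₂ hd₁).flip hm₂
  · obtain ⟨p, rfl⟩ := stabMk_surjective (Y := W.as.obj) f
    obtain ⟨q, rfl⟩ := stabMk_surjective (Y := W.as.obj) g
    exact stabMk_eq_iff.2 (.of_isSum h h₁ h₂)

theorem stabFunctor_preservesFiniteCoproducts : PreservesFiniteCoproducts (stabFunctor C) := by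
  have hbin : PreservesColimitsOfShape (Discrete WalkingPair) (stabFunctor C) := by
    refine ⟨fun {K} => ?_⟩
    have (X Y : InternalPreorder C) : PreservesColimit (pair X Y) (stabFunctor C) :=
      preservesColimit_of_preserves_colimit_cocone (isSum_inl_inr (X := X) (Y := Y)).some
        ((isColimitMapCoconeBinaryCofanEquiv _ _ _).symm
          (isSum_stabFunctor_map isSum_inl_inr).some)
    exact preservesColimit_of_iso_diagram _ (diagramIsoPair K).symm
  have hinit : PreservesColimitsOfShape (Discrete PEmpty.{1}) (stabFunctor C) := by
    have := preservesInitial_of_iso (stabFunctor C) (initialIsInitial.uniqueUpToIso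
      (stab_isZero_empty.isInitial.ofIso ((stabFunctor C).mapIso
        (empty_isInitial.some.uniqueUpToIso initialIsInitial))))
    exact preservesColimitsOfShape_pempty_of_preservesInitial _
  exact ⟨fun n => PreservesFiniteCoproducts.of_preserves_binary_and_initial _ (Fin n)⟩

end StableCongruence

/-! ### The largest equivalence relation contained in a preorder -/

namespace InternalPreorder

variable {C : Type u} [Category.{v} C] [IsPretopos C] {A B W X Y Z : InternalPreorder C}

section Core

variable (X)

/-- The object of pairs of elements `x`, `y` of `X` with `x ≤ y` and `y ≤ x`, together with its
two projections `coreRel₁` and `coreRel₂`. -/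
noncomputable abbrev coreRel : C := pullback (prod.lift X.r₁ X.r₂) (prod.lift X.r₂ X.r₁)

/-- The first projection of the symmetric part of the preorder. -/
noncomputable abbrev coreRel₁ : coreRel X ⟶ X.carrier := pullback.fst _ _ ≫ X.r₁

/-- The second projection of the symmetric part of the preorder. -/
noncomputable abbrev coreRel₂ : coreRel X ⟶ X.carrier := pullback.fst _ _ ≫ X.r₂

variable {X}

theorem exists_coreRel_iff {T : C} {x y : T ⟶ X.carrier} :
    (∃ h : T ⟶ coreRel X, h ≫ coreRel₁ X = x ∧ h ≫ coreRel₂ X = y) ↔ X.le x y ∧ X.le y x := by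
  have c := pullback.condition (f := prod.lift X.r₁ X.r₂) (g := prod.lift X.r₂ X.r₁)
  have c₁ := c =≫ prod.fst
  have c₂ := c =≫ prod.snd
  rw [Category.assoc, Category.assoc, prod.lift_fst, prod.lift_fst] at c₁
  rw [Category.assoc, Category.assoc, prod.lift_snd, prod.lift_snd] at c₂
  constructor
  · rintro ⟨h, rfl, rfl⟩
    refine ⟨⟨h ≫ pullback.fst _ _, Category.assoc _ _ _, Category.assoc _ _ _⟩,
      ⟨h ≫ pullback.snd _ _, ?_, ?_⟩⟩
    · rw [Category.assoc, ← c₂, coreRel₂]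
    · rw [Category.assoc, ← c₁, coreRel₁]
  · rintro ⟨⟨h, rfl, rfl⟩, ⟨k, h₁, h₂⟩⟩
    refine ⟨pullback.lift h k ?_, ?_, ?_⟩
    · apply Limits.prod.hom_ext <;> simp [h₁, h₂]
    · rw [coreRel₁, pullback.lift_fst_assoc]
    · rw [coreRel₂, pullback.lift_fst_assoc]

variable (X)

theorem coreRel_jointlyMono : JointlyMono₂ (coreRel₁ X) (coreRel₂ X) where
  right_cancellation T f g h₁ h₂ := by
    have h : f ≫ pullback.fst _ _ = g ≫ pullback.fst _ _ :=
      X.rel_hom_ext (by simpa only [coreRel₁, Category.assoc] using h₁)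
        (by simpa only [coreRel₂, Category.assoc] using h₂)
    have : Mono (prod.lift X.r₂ X.r₁) := ⟨fun a b e => X.rel_hom_ext
      (by simpa only [Category.assoc, prod.lift_snd] using e =≫ prod.snd)
      (by simpa only [Category.assoc, prod.lift_fst] using e =≫ prod.fst)⟩
    exact (cancel_mono (pullback.fst _ _)).1 h

/-- The largest equivalence relation contained in a preorder: its torsion part. -/
noncomputable def core : InternalPreorder C where
  carrier := X.carrier
  rel := coreRel X
  r₁ := coreRel₁ X
  r₂ := coreRel₂ X
  jointlyMono := coreRel_jointlyMono X
  reflexive := exists_coreRel_iff.2 ⟨X.le_refl _, X.le_refl _⟩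
  transitive := by
    have h := exists_coreRel_iff.1 ⟨pullback.fst (coreRel₂ X) (coreRel₁ X), rfl, rfl⟩
    have k := exists_coreRel_iff.1 ⟨pullback.snd (coreRel₂ X) (coreRel₁ X), rfl, rfl⟩
    rw [pullback.condition] at h
    exact exists_coreRel_iff.2 ⟨X.le_trans h.1 k.1, X.le_trans k.2 h.2⟩

theorem core_le_iff {T : C} {x y : T ⟶ X.carrier} :
    (core X).le x y ↔ X.le x y ∧ X.le y x :=
  exists_coreRel_iff

/-- The inclusion of the torsion part of a preorder. -/
noncomputable def coreι : core X ⟶ X where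
  base := 𝟙 X.carrier
  rel := pullback.fst _ _
  w₁ := Category.comp_id _
  w₂ := Category.comp_id _

instance : Mono (coreι X) := mono_of_base _ (inferInstanceAs (Mono (𝟙 X.carrier)))

theorem isEquivalence_core : isEquivalence (core X) :=
  isEquivalence_iff.2 fun _ x y h =>
    (core_le_iff X).2 ((core_le_iff X (x := x) (y := y)).1 h).symm

/-- A pretopos has quotients of preorders by their symmetric parts. -/
theorem exists_effective_core :
    ∃ (Q : C) (q : X.carrier ⟶ Q), IsRegularEpi q ∧
      ∀ ⦃T : C⦄ (x y : T ⟶ X.carrier), x ≫ q = y ≫ q ↔ X.le x y ∧ X.le y x := by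
  have : IsEquivalenceRelation (coreRel₁ X) (coreRel₂ X) := by
    have hr := (core X).reflexive
    have hs := isEquivalence_core X
    have ht := (core X).transitive
    exact ⟨⟨{ right_cancellation := (coreRel_jointlyMono X).right_cancellation
              r := hr.choose
              reflexivity₁ := hr.choose_spec.1
              reflexivity₂ := hr.choose_spec.2
              s := hs.choose
              symmetry₁ := hs.choose_spec.1
              symmetry₂ := hs.choose_spec.2
              c := _
              isLimit := pullbackIsPullback (coreRel₂ X) (coreRel₁ X)
              t := ht.choose
              transitivity₁ := ht.choose_spec.1
              transitivity₂ := ht.choose_spec.2 }⟩⟩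
  obtain ⟨⟨e⟩⟩ := IsPretopos.effective (coreRel₁ X) (coreRel₂ X) this
  refine ⟨e.B, e.π, inferInstance, fun T x y => ?_⟩
  rw [← exists_coreRel_iff]
  constructor
  · intro h
    exact ⟨e.isKernelPair.lift x y h, e.isKernelPair.lift_fst _ _ _, e.isKernelPair.lift_snd _ _ _⟩
  · rintro ⟨h, rfl, rfl⟩
    exact (Category.assoc _ _ _).trans ((h ≫= e.isKernelPair.w).trans (Category.assoc _ _ _).symm)

end Core

/-! ### The reflection of preorders in partial orders -/

/-- A relation is determined by its generalized elements locally for regular epimorphisms. -/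
theorem exists_lift_of_isRegularEpi {D : Type u₁} [Category.{v₁} D] {R S T V : D}
    {r₁ r₂ : R ⟶ V} (hr : JointlyMono₂ r₁ r₂)
    (c : S ⟶ T) [IsRegularEpi c] {x y : T ⟶ V} (h : S ⟶ R) (h₁ : h ≫ r₁ = c ≫ x)
    (h₂ : h ≫ r₂ = c ≫ y) : ∃ l : T ⟶ R, c ≫ l = h ∧ l ≫ r₁ = x ∧ l ≫ r₂ = y := by
  have w : IsRegularEpi.left c ≫ h = IsRegularEpi.right c ≫ h := by
    apply hr.right_cancellation
    · rw [Category.assoc, h₁, Category.assoc, h₁, reassoc_of% IsRegularEpi.w c]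
    · rw [Category.assoc, h₂, Category.assoc, h₂, reassoc_of% IsRegularEpi.w c]
  refine ⟨IsRegularEpi.desc c h w, IsRegularEpi.fac c h w, ?_, ?_⟩
  · rw [← cancel_epi c, IsRegularEpi.fac_assoc, h₁]
  · rw [← cancel_epi c, IsRegularEpi.fac_assoc, h₂]

/-- The morphism `q` is the quotient of `X` by the symmetric part of its preorder, with the image
of the preorder as order relation on `Y`. -/
structure IsPosetReflection (q : X ⟶ Y) : Prop where
  base : IsRegularEpi q.base
  rel : IsRegularEpi q.rel
  eq_iff : ∀ ⦃T : C⦄ (x y : T ⟶ X.carrier), x ≫ q.base = y ≫ q.base ↔ X.le x y ∧ X.le y x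

theorem exists_isPosetReflection (X : InternalPreorder C) :
    ∃ (Y : InternalPreorder C) (q : X ⟶ Y), isPartialOrder Y ∧ IsPosetReflection q := by
  obtain ⟨Q, q, hq, hqe⟩ := exists_effective_core X
  -- The order on `Q` is the image of the preorder of `X`.
  obtain ⟨I, m, e, hm, he, fac⟩ :
      ∃ (I : C) (m : I ⟶ Q ⨯ Q) (e : X.rel ⟶ I), Mono m ∧ IsRegularEpi e ∧
        e ≫ m = prod.lift (X.r₁ ≫ q) (X.r₂ ≫ q) :=
    let F := Regular.strongEpiMonoFactorisation (prod.lift (X.r₁ ≫ q) (X.r₂ ≫ q))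
    ⟨F.I, F.m, F.e, inferInstance, inferInstance, F.fac⟩
  obtain ⟨s₁, hs₁⟩ : ∃ s₁ : I ⟶ Q, s₁ = m ≫ prod.fst := ⟨_, rfl⟩
  obtain ⟨s₂, hs₂⟩ : ∃ s₂ : I ⟶ Q, s₂ = m ≫ prod.snd := ⟨_, rfl⟩
  have hes₁ : e ≫ s₁ = X.r₁ ≫ q := by rw [hs₁, reassoc_of% fac, prod.lift_fst]
  have hes₂ : e ≫ s₂ = X.r₂ ≫ q := by rw [hs₂, reassoc_of% fac, prod.lift_snd]
  have hjm : JointlyMono₂ s₁ s₂ := ⟨fun T f g h₁ h₂ => by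
    rw [← cancel_mono m]
    apply Limits.prod.hom_ext
    · simpa [hs₁] using h₁
    · simpa [hs₂] using h₂⟩
  -- Two generalized elements of the image lift to the preorder of `X` on a common cover.
  have cover {T : C} (h k : T ⟶ I) : ∃ (S : C) (c : S ⟶ T) (a b : S ⟶ X.rel),
      IsRegularEpi c ∧ Epi c ∧ c ≫ h = a ≫ e ∧ c ≫ k = b ≫ e := by
    let c₁ := pullback.fst h e
    let c₂ := pullback.fst (c₁ ≫ k) e
    have : Epi (c₂ ≫ c₁) := epi_comp _ _
    have : IsRegularEpi (c₂ ≫ c₁) := inferInstance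
    refine ⟨_, c₂ ≫ c₁, c₂ ≫ pullback.snd h e, pullback.snd (c₁ ≫ k) e, this, inferInstance,
      ?_, ?_⟩
    · rw [Category.assoc, Category.assoc, pullback.condition]
    · rw [Category.assoc, pullback.condition]
  have le_of_eq {T : C} {x y : T ⟶ X.carrier} (h : x ≫ q = y ≫ q) : X.le x y :=
    ((hqe x y).1 h).1
  let Y : InternalPreorder C :=
    { carrier := Q
      rel := I
      r₁ := s₁
      r₂ := s₂
      jointlyMono := hjm
      reflexive := by
        obtain ⟨i, h₁, h₂⟩ := X.reflexive
        obtain ⟨l, -, hl⟩ := exists_lift_of_isRegularEpi hjm q (x := 𝟙 Q) (y := 𝟙 Q) (i ≫ e)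
          (by rw [Category.assoc, hes₁, reassoc_of% h₁, Category.comp_id])
          (by rw [Category.assoc, hes₂, reassoc_of% h₂, Category.comp_id])
        exact ⟨l, hl⟩
      transitive := by
        obtain ⟨S, c, a, b, hc, -, ha, hb⟩ := cover (pullback.fst s₂ s₁) (pullback.snd s₂ s₁)
        obtain ⟨w, hw₁, hw₂⟩ := X.le_trans (x := a ≫ X.r₁) (z := b ≫ X.r₂) ⟨a, rfl, rfl⟩
          (X.le_trans (le_of_eq (y := b ≫ X.r₁) (by
            rw [Category.assoc, Category.assoc, ← hes₁, ← hes₂, ← reassoc_of% ha,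
              ← reassoc_of% hb, pullback.condition])) ⟨b, rfl, rfl⟩)
        obtain ⟨l, -, hl⟩ := exists_lift_of_isRegularEpi hjm c
          (x := pullback.fst s₂ s₁ ≫ s₁) (y := pullback.snd s₂ s₁ ≫ s₂) (w ≫ e)
          (by rw [Category.assoc, hes₁, reassoc_of% hw₁, reassoc_of% ha, hes₁])
          (by rw [Category.assoc, hes₂, reassoc_of% hw₂, reassoc_of% hb, hes₂])
        exact ⟨l, hl⟩ }
  refine ⟨Y, ⟨q, e, hes₁.symm, hes₂.symm⟩, ?_, hq, he, hqe⟩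
  rintro T _ _ ⟨h, rfl, rfl⟩ ⟨k, hk₁, hk₂⟩
  obtain ⟨S, c, a, b, -, hc, ha, hb⟩ := cover h k
  change k ≫ s₁ = h ≫ s₂ at hk₁
  change k ≫ s₂ = h ≫ s₁ at hk₂
  change h ≫ s₁ = h ≫ s₂
  have h₁ : X.le (a ≫ X.r₂) (b ≫ X.r₁) := le_of_eq (by
    rw [Category.assoc, Category.assoc, ← hes₁, ← hes₂, ← reassoc_of% ha, ← reassoc_of% hb, hk₁])
  have h₂ : X.le (b ≫ X.r₂) (a ≫ X.r₁) := le_of_eq (by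
    rw [Category.assoc, Category.assoc, ← hes₁, ← hes₂, ← reassoc_of% ha, ← reassoc_of% hb, hk₂])
  rw [← cancel_epi c, reassoc_of% ha, reassoc_of% ha, hes₁, hes₂, ← Category.assoc,
    ← Category.assoc]
  exact (hqe _ _).2 ⟨⟨a, rfl, rfl⟩, X.le_trans h₁ (X.le_trans ⟨b, rfl, rfl⟩ h₂)⟩

theorem isPullback_base_rel {f : X ⟶ Z} {g : Y ⟶ Z} {a : W ⟶ X} {b : W ⟶ Y}
    (h : IsPullback a b f g) :
    IsPullback a.base b.base f.base g.base ∧ IsPullback a.rel b.rel f.rel g.rel := by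
  let e := h.isoIsPullback _ _ (pb_isPullback f g)
  have h₁ : e.hom ≫ pbFst f g = a := h.isoIsPullback_hom_fst _ _ _
  have h₂ : e.hom ≫ pbSnd f g = b := h.isoIsPullback_hom_snd _ _ _
  exact ⟨IsPullback.of_iso_pullback ⟨congrArg Hom.base h.w⟩
      (@asIso _ _ _ _ e.hom.base (isIso_base _)) (congrArg Hom.base h₁) (congrArg Hom.base h₂),
    IsPullback.of_iso_pullback ⟨congrArg Hom.rel h.w⟩
      (@asIso _ _ _ _ e.hom.rel (isIso_rel _)) (congrArg Hom.rel h₁) (congrArg Hom.rel h₂)⟩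

theorem isTrivialHom_of_epi_comp {q : X ⟶ Y} [Epi q.rel] {f : Y ⟶ Z}
    (h : IsTrivialHom isTrivial (q ≫ f)) : IsTrivialHom isTrivial f := by
  rw [isTrivialHom_iff] at h ⊢
  rw [← cancel_epi q.rel, ← reassoc_of% q.w₁, ← reassoc_of% q.w₂]
  exact h

namespace IsPosetReflection

variable {q : X ⟶ Y}

theorem epi_rel (hq : IsPosetReflection q) : Epi q.rel :=
  have := hq.rel
  inferInstance

theorem epi (hq : IsPosetReflection q) : Epi q :=
  have := hq.base
  ⟨fun _ _ h => hom_ext ((cancel_epi q.base).1 (congrArg Hom.base h))⟩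

theorem exists_desc (hq : IsPosetReflection q) (f : X ⟶ W)
    (hf : ∀ ⦃T : C⦄ (x y : T ⟶ X.carrier), X.le x y → X.le y x → x ≫ f.base = y ≫ f.base) :
    ∃ g : Y ⟶ W, q ≫ g = f := by
  have := hq.base
  have := hq.rel
  have w : IsRegularEpi.left q.base ≫ f.base = IsRegularEpi.right q.base ≫ f.base :=
    have h := (hq.eq_iff _ _).1 (IsRegularEpi.w q.base)
    hf _ _ h.1 h.2
  have fac := IsRegularEpi.fac q.base f.base w
  obtain ⟨l, hl, h₁, h₂⟩ := exists_lift_of_isRegularEpi W.jointlyMono q.rel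
    (x := Y.r₁ ≫ IsRegularEpi.desc q.base f.base w) (y := Y.r₂ ≫ IsRegularEpi.desc q.base f.base w)
    f.rel (by rw [← reassoc_of% q.w₁, fac, f.w₁]) (by rw [← reassoc_of% q.w₂, fac, f.w₂])
  exact ⟨⟨_, l, h₁.symm, h₂.symm⟩, hom_ext fac⟩

/-- The reflection in partial orders is stable under pullback along coprojections. -/
theorem of_isPullback (hq : IsPosetReflection q) {α : A ⟶ X} {β : B ⟶ X} (h : IsSum α β)
    {A' : InternalPreorder C} {α' : A' ⟶ Y} [Mono α'] {q' : A ⟶ A'} (hp : IsPullback α q' q α') :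
    IsPosetReflection q' := by
  have := mono_base α'
  obtain ⟨hb, hr⟩ := isPullback_base_rel hp
  have e {T : C} (x : T ⟶ A.carrier) : (x ≫ α.base) ≫ q.base = (x ≫ q'.base) ≫ α'.base := by
    rw [Category.assoc, Category.assoc, hb.w]
  refine ⟨Regular.regularEpiIsStableUnderBaseChange.of_isPullback hb hq.base,
    Regular.regularEpiIsStableUnderBaseChange.of_isPullback hr hq.rel, fun T x y => ?_⟩
  rw [← cancel_mono α'.base, ← e, ← e, hq.eq_iff]
  exact ⟨fun k => ⟨le_of_isSum_inl h k.1, le_of_isSum_inl h k.2⟩,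
    fun k => ⟨α.monotone k.1, α.monotone k.2⟩⟩

/-- A coproduct decomposition of `X` is the pullback of a coproduct decomposition of the reflection
of `X`: it is classified by a morphism to the discrete preorder `1 ⨿ 1`, which factors through the
reflection. -/
theorem exists_isSum (hq : IsPosetReflection q) {α : A ⟶ X} {β : B ⟶ X} (h : IsSum α β) :
    ∃ (A' B' : InternalPreorder C) (α' : A' ⟶ Y) (β' : B' ⟶ Y) (a : A ⟶ A') (b : B ⟶ B'),
      IsSum α' β' ∧ IsPullback α a q α' ∧ IsPullback β b q β' ∧
      IsPosetReflection a ∧ IsPosetReflection b := by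
  let D : InternalPreorder C := discrete (⊤_ C)
  have bang (V : InternalPreorder C) : Nonempty (V ⟶ D) :=
    ⟨⟨terminal.from _, terminal.from _, terminal.hom_ext _ _, terminal.hom_ext _ _⟩⟩
  obtain ⟨s⟩ := bang A
  obtain ⟨t⟩ := bang B
  obtain ⟨χ, hα, hβ⟩ := h.exists_desc (s ≫ inl D D) (t ≫ inr D D)
  obtain ⟨χ', rfl⟩ := hq.exists_desc χ fun T x y hxy _ => by
    obtain ⟨k, h₁, h₂⟩ := χ.monotone hxy
    exact h₁.symm.trans h₂
  have hs := isSum_pullback (isSum_inl_inr (X := D) (Y := D)) χ'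
  have wα : (α ≫ q) ≫ χ' = s ≫ inl D D := by rw [Category.assoc, hα]
  have wβ : (β ≫ q) ≫ χ' = t ≫ inr D D := by rw [Category.assoc, hβ]
  have hα' : α ≫ q = (pb_isPullback _ _).lift _ _ wα ≫ pbFst χ' (inl D D) :=
    ((pb_isPullback _ _).lift_fst _ _ _).symm
  have hβ' : β ≫ q = (pb_isPullback _ _).lift _ _ wβ ≫ pbFst χ' (inr D D) :=
    ((pb_isPullback _ _).lift_fst _ _ _).symm
  have pα := isPullback_of_isSum h hs hα' hβ'
  have pβ := isPullback_of_isSum h.symm hs.symm hβ' hα'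
  have := isSum_mono_inl hs
  have := isSum_mono_inl hs.symm
  exact ⟨_, _, _, _, _, _, hs, pα, pβ, hq.of_isPullback h pα, hq.of_isPullback h.symm pβ⟩

end IsPosetReflection

end InternalPreorder

section TorsionTheory

variable {C : Type u} [Category.{v} C] [IsPretopos C] {A B W X Y Z : InternalPreorder C}

/-! ### The canonical short exact sequence of internal preorders -/

theorem coreι_comp_base (f : X ⟶ Y) : (coreι X ≫ f).base = f.base := Category.id_comp _

theorem isZKernel_coreι {q : X ⟶ Y} (hq : IsPosetReflection q) :
    IsZKernel isTrivial (coreι X) q := by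
  constructor
  · rw [isTrivialHom_iff_le]
    intro T x y h
    rw [coreι_comp_base]
    exact (hq.eq_iff x y).2 ((core_le_iff X).1 h)
  · intro V l hl
    rw [isTrivialHom_iff, comp_base, ← Category.assoc, ← Category.assoc, hq.eq_iff,
      ← core_le_iff] at hl
    obtain ⟨k, h₁, h₂⟩ := hl
    refine ⟨⟨l.base, k, h₁.symm, h₂.symm⟩, hom_ext (Category.comp_id _), fun m hm => ?_⟩
    rw [← cancel_mono (coreι X), hm]
    exact hom_ext (Category.comp_id _).symm

theorem isZCokernel_coreι {q : X ⟶ Y} (hq : IsPosetReflection q) :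
    IsZCokernel isTrivial (coreι X) q := by
  refine ⟨(isZKernel_coreι hq).1, fun V l hl => ?_⟩
  obtain ⟨m, hm⟩ := hq.exists_desc l fun T x y h h' => by
    rw [← coreι_comp_base]
    exact isTrivialHom_iff_le.1 hl x y ((core_le_iff X).2 ⟨h, h'⟩)
  have := hq.epi
  exact ⟨m, hm, fun m' hm' => by rw [← cancel_epi q, hm, hm']⟩

theorem isShortZExact_coreι {q : X ⟶ Y} (hq : IsPosetReflection q) :
    IsShortZExact isTrivial (coreι X) q :=
  ⟨isZKernel_coreι hq, isZCokernel_coreι hq⟩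

theorem isEquivalence_isClosedUnderIsomorphisms :
    (isEquivalence (C := C)).IsClosedUnderIsomorphisms where
  of_iso {X _} e hX := isEquivalence_of_isSum_inl
    (IsSum.of_isIso (i₁ := e.inv) empty_isInitial.some (empty_isInitial.some.to X)) hX

theorem isPartialOrder_isClosedUnderIsomorphisms :
    (isPartialOrder (C := C)).IsClosedUnderIsomorphisms where
  of_iso e hX := isPartialOrder_of_mono e.inv hX

variable (C) in
theorem isPretorsionTheory_isEquivalence_isPartialOrder :
    IsPretorsionTheory (isEquivalence (C := C)) isPartialOrder where
  replete_torsion := isEquivalence_isClosedUnderIsomorphisms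
  replete_torsionFree := isPartialOrder_isClosedUnderIsomorphisms
  trivial_hom _ _ f hX hY := isTrivialHom_of_isEquivalence_of_isPartialOrder f hX hY
  exists_exact X := by
    obtain ⟨Y, q, hY, hq⟩ := exists_isPosetReflection X
    exact ⟨core X, Y, isEquivalence_core X, hY, coreι X, q, isShortZExact_coreι hq⟩

/-! ### The canonical short exact sequence in the stable category -/

namespace InternalPreorder.IsPosetReflection

variable {q : X ⟶ Y}

/-- The reflection `q` is an epimorphism in the stable category: the common subobject that witnesses
a stable equality after composition with `q` descends to `Y`, and so do its complements. -/
theorem epi_stabFunctor_map (hq : IsPosetReflection q) : Epi ((stabFunctor C).map q) := by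
  refine ⟨fun {V} g h e => ?_⟩
  obtain ⟨p, rfl⟩ := stabMk_surjective (Y := V.as.obj) g
  obtain ⟨r, rfl⟩ := stabMk_surjective (Y := V.as.obj) h
  have restrict (s : PartialMap Y V.as.obj) :=
    map_comp_stabMk q s ⟨_, pbFst q s.ι, s.complemented.pullback q, pbSnd q s.ι ≫ s.map⟩ _
      (pb_isPullback q s.ι) rfl
  replace e := (restrict p).symm.trans (e.trans (restrict r))
  obtain ⟨A, α, β, h₁, h₂, ⟨E, ε, hα, hε⟩, ⟨F, φ, hβ, hφ⟩⟩ := stabMk_eq_iff.1 e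
  have refl (s : PartialMap Y V.as.obj) : IsPosetReflection (pbSnd q s.ι) := by
    have := s.complemented.mono
    obtain ⟨_, _, hs⟩ := isComplemented_iff_exists_isSum.1 s.complemented
    exact hq.of_isPullback (isSum_pullback hs q) (pb_isPullback q s.ι)
  -- The decompositions of the domains over `X` descend to decompositions of the domains over `Y`.
  obtain ⟨A₁, E', α', ε', a, c, hs, pa, pc, ha, hc⟩ := (refl p).exists_isSum hα
  obtain ⟨A₂, F', β', φ', b, d, ht, pb, pd, hb, hd⟩ := (refl r).exists_isSum hβ
  -- Both `A₁` and `A₂` are reflections of `A`, hence isomorphic.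
  obtain ⟨u, hu⟩ := ha.exists_desc b fun T x y k l => (hb.eq_iff x y).2 ⟨k, l⟩
  obtain ⟨w, hw⟩ := hb.exists_desc a fun T x y k l => (ha.eq_iff x y).2 ⟨k, l⟩
  have := ha.epi
  have := hb.epi
  let i : A₁ ≅ A₂ :=
    ⟨u, w, by rw [← cancel_epi a, reassoc_of% hu, hw, Category.comp_id],
      by rw [← cancel_epi b, reassoc_of% hw, hu, Category.comp_id]⟩
  refine stabMk_eq_iff.2 ⟨A₁, α', u ≫ β', ?_, ?_, ⟨E', ε', hs, ?_⟩, ⟨F', φ', ?_, ?_⟩⟩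
  · rw [← cancel_epi a, Category.assoc, reassoc_of% hu, ← reassoc_of% pa.w, ← reassoc_of% pb.w,
      ← pb_condition, ← pb_condition, ← Category.assoc, ← Category.assoc]
    exact h₁ =≫ q
  · rw [← cancel_epi a, Category.assoc, reassoc_of% hu, ← reassoc_of% pa.w, ← reassoc_of% pb.w]
    exact h₂
  · have := hc.epi_rel
    refine isTrivialHom_of_epi_comp (q := c) ?_
    rw [← reassoc_of% pc.w]
    exact hε
  · simpa [i] using ht.iso_comp i (Iso.refl _)
  · have := hd.epi_rel
    refine isTrivialHom_of_epi_comp (q := d) ?_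
    rw [← reassoc_of% pd.w]
    exact hφ

theorem exists_stabMk_lift (hq : IsPosetReflection q) (p : PartialMap W X)
    (h : stabMk p ≫ (stabFunctor C).map q = 0) :
    ∃ r : PartialMap W (core X), stabMk r ≫ (stabFunctor C).map (coreι X) = stabMk p := by
  rw [stabMk_comp_map, stabMk_eq_zero_iff] at h
  obtain ⟨l, hl, -⟩ := (isZKernel_coreι hq).2 p.map h
  exact ⟨⟨p.dom, p.ι, p.complemented, l⟩, by rw [stabMk_comp_map, hl]⟩

/-- A partial map on `X` that vanishes on the torsion part of `X` factors through the reflection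
of `X`: its domain, being complemented, is the pullback of a complemented subobject of the
reflection, along which the map itself descends. -/
theorem exists_stabMk_desc (hq : IsPosetReflection q) (p : PartialMap X W)
    (h : (stabFunctor C).map (coreι X) ≫ stabMk p = 0) :
    ∃ r : PartialMap Y W, (stabFunctor C).map q ≫ stabMk r = stabMk p := by
  rw [map_comp_stabMk (coreι X) p
    ⟨_, pbFst (coreι X) p.ι, p.complemented.pullback _, pbSnd (coreι X) p.ι ≫ p.map⟩ _
    (pb_isPullback _ _) rfl, stabMk_eq_zero_iff, isTrivialHom_iff_le] at h
  obtain ⟨B, β, hp⟩ := isComplemented_iff_exists_isSum.1 p.complemented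
  obtain ⟨A', B', α', β', a, b, hs, pa, -, ha, -⟩ := hq.exists_isSum hp
  obtain ⟨m, hm⟩ := ha.exists_desc p.map fun T x y hxy hyx => by
    have c := isPullback_base_rel (pb_isPullback (coreι X) p.ι)
    have lift (z : T ⟶ p.dom.carrier) : ∃ z' : T ⟶ (pb (coreι X) p.ι).carrier,
        z' ≫ (pbFst (coreι X) p.ι).base = z ≫ p.ι.base ∧ z' ≫ (pbSnd (coreι X) p.ι).base = z :=
      ⟨c.1.lift (z ≫ p.ι.base) z (Category.comp_id _), c.1.lift_fst _ _ _, c.1.lift_snd _ _ _⟩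
    obtain ⟨x', hx₁, hx₂⟩ := lift x
    obtain ⟨y', hy₁, hy₂⟩ := lift y
    have key := h x' y' (le_of_isSum_inl (isSum_pullback hp (coreι X)) (by
      rw [hx₁, hy₁]
      exact (core_le_iff X).2 ⟨p.ι.monotone hxy, p.ι.monotone hyx⟩))
    rw [← hx₂, ← hy₂, Category.assoc, Category.assoc]
    exact key
  exact ⟨⟨A', α', isComplemented_iff_exists_isSum.2 ⟨_, _, hs⟩, m⟩,
    map_comp_stabMk _ _ p a pa hm⟩

end InternalPreorder.IsPosetReflection

theorem isShortExactSeq_of_mono_of_epi {D : Type u₁} [Category.{v₁} D] [HasZeroMorphisms D]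
    {K P Q : D} (f : K ⟶ P) (g : P ⟶ Q) [Mono f] [Epi g] (w : f ≫ g = 0)
    (hf : ∀ ⦃V : D⦄ (l : V ⟶ P), l ≫ g = 0 → ∃ l', l' ≫ f = l)
    (hg : ∀ ⦃V : D⦄ (l : P ⟶ V), f ≫ l = 0 → ∃ l', g ≫ l' = l) : IsShortExactSeq f g :=
  ⟨w, ⟨KernelFork.IsLimit.ofι' f w fun l hl => ⟨_, (hf l hl).choose_spec⟩⟩,
    ⟨CokernelCofork.IsColimit.ofπ' g w fun l hl => ⟨_, (hg l hl).choose_spec⟩⟩⟩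

/-- The canonical sequence of `X`, up to isomorphism, is short exact in the stable category. -/
theorem isShortExactSeq_stabFunctor_map {q : X ⟶ Y} (hq : IsPosetReflection q)
    {K Q : InternalPreorder C} (e : K ≅ core X) (e' : Y ≅ Q) :
    IsShortExactSeq ((stabFunctor C).map (e.hom ≫ coreι X))
      ((stabFunctor C).map (q ≫ e'.hom)) := by
  have := hq.epi_stabFunctor_map
  have := mono_stabFunctor_map (e.hom ≫ coreι X)
  have : Epi ((stabFunctor C).map (q ≫ e'.hom)) := by
    rw [Functor.map_comp]
    infer_instance
  refine isShortExactSeq_of_mono_of_epi _ _ ?_ (fun V l hl => ?_) fun V l hl => ?_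
  · rw [← Functor.map_comp]
    have := isTrivialHom_comp (isTrivialHom_precomp (isZKernel_coreι hq).1 e.hom) e'.hom
    exact stabFunctor_map_eq_zero (by simpa using this)
  · obtain ⟨V, rfl⟩ := stabFunctor_obj_surjective V
    obtain ⟨p, rfl⟩ := stabMk_surjective l
    rw [Functor.map_comp, ← Category.assoc, ← zero_comp, cancel_mono] at hl
    obtain ⟨r, hr⟩ := hq.exists_stabMk_lift p hl
    exact ⟨stabMk r ≫ (stabFunctor C).map e.inv, by simp [← Functor.map_comp_assoc, hr]⟩
  · obtain ⟨V, rfl⟩ := stabFunctor_obj_surjective V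
    obtain ⟨p, rfl⟩ := stabMk_surjective l
    rw [Functor.map_comp, Category.assoc, ← comp_zero, cancel_epi] at hl
    obtain ⟨r, hr⟩ := hq.exists_stabMk_desc p hl
    exact ⟨(stabFunctor C).map e'.inv ≫ stabMk r, by simp [← Functor.map_comp_assoc, hr]⟩

/-- Short exact sequences with torsion kernel and torsion-free cokernel are unique up to
isomorphism, so the stable functor preserves all of them. -/
theorem isShortExactSeq_stabFunctor_map_of_isShortZExact {K Q : InternalPreorder C} (f : K ⟶ X)
    (g : X ⟶ Q) (hK : isEquivalence K) (hQ : isPartialOrder Q)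
    (h : IsShortZExact isTrivial f g) :
    IsShortExactSeq ((stabFunctor C).map f) ((stabFunctor C).map g) := by
  obtain ⟨Y, q, hY, hq⟩ := exists_isPosetReflection X
  have hk := isZKernel_coreι hq
  have hc := isZCokernel_coreι hq
  have := hq.epi
  have tf := isTrivialHom_of_isEquivalence_of_isPartialOrder (f ≫ q) hK hY
  have tg := isTrivialHom_of_isEquivalence_of_isPartialOrder (coreι X ≫ g)
    (isEquivalence_core X) hQ
  obtain ⟨u, hu, -⟩ := hk.2 f tf
  obtain ⟨u', hu', -⟩ := h.1.2 (coreι X) tg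
  obtain ⟨w, hw, -⟩ := hc.2 g tg
  obtain ⟨w', hw', -⟩ := h.2.2 q tf
  let e : K ≅ core X :=
    ⟨u, u', (h.1.2 f h.1.1).unique (by rw [Category.assoc, hu', hu]) (Category.id_comp f),
      by rw [← cancel_mono (coreι X), Category.assoc, hu, hu', Category.id_comp]⟩
  let e' : Y ≅ Q :=
    ⟨w, w', by rw [← cancel_epi q, reassoc_of% hw, hw', Category.comp_id],
      (h.2.2 g h.2.1).unique (by rw [reassoc_of% hw', hw]) (Category.comp_id g)⟩
  have key := isShortExactSeq_stabFunctor_map hq e e'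
  rwa [show e.hom ≫ coreι X = f from hu, show q ≫ e'.hom = g from hw] at key

variable (C) in
theorem isTorsionTheory_stabEquivalence_stabPartialOrder :
    IsTorsionTheory (stabEquivalence (C := C)) stabPartialOrder where
  replete_torsion := stabEquivalence_isClosedUnderIsomorphisms
  replete_torsionFree := stabPartialOrder_isClosedUnderIsomorphisms
  zero_hom _ _ f hX hY := stab_zero_hom f hX hY
  exists_exact X := by
    obtain ⟨Y, q, hY, hq⟩ := exists_isPosetReflection X.as.obj
    exact ⟨(stabFunctor C).obj (core X.as.obj), (stabFunctor C).obj Y,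
      isEquivalence_core X.as.obj, hY, _, _,
      isShortExactSeq_stabFunctor_map_of_isShortZExact (coreι X.as.obj) q
        (isEquivalence_core X.as.obj) hY (isShortZExact_coreι hq)⟩

end TorsionTheory

theorem mainTheorem3 (C : Type u) [Category.{v} C] [IsPretopos C] :
    IsPretorsionTheory (isEquivalence (C := C)) isPartialOrder ∧
    IsTorsionTheory (stabEquivalence (C := C)) stabPartialOrder ∧
    IsTorsionTheoryFunctor isEquivalence isPartialOrder stabEquivalence stabPartialOrder
      (stabFunctor C) ∧
    PreservesFiniteCoproducts (stabFunctor C) ∧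
    (stabFunctor C).PreservesMonomorphisms := by
  have h₁ := isPretorsionTheory_isEquivalence_isPartialOrder C
  have h₂ := isTorsionTheory_stabEquivalence_stabPartialOrder C
  exact ⟨h₁, h₂, ⟨h₁, h₂, fun _ hX => hX, fun _ hX => hX,
    fun _ _ _ f g => isShortExactSeq_stabFunctor_map_of_isShortZExact f g⟩,
    stabFunctor_preservesFiniteCoproducts, stabFunctor_preservesMonomorphisms⟩
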